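/- Let $n\ge 0$ and let $\eta_0,\dots,\eta_n$ be real i.i.d. random variables with $\mathbb E[\eta_k]=0$, $\mathbb E[\eta_k^2]=1$ and common characteristic function $\phi(s)=\mathbb E[e^{is\eta_k}]$. Let $f_0,\dots,f_n$ be entire functions that are real valued on the real line, and put $P_n(z)=\sum_{k=0}^n\eta_kf_k(z)$. For $x\in\mathbb R$ let $$K_n=\sum_{j=0}^n f_j(x)^2,\quad K_n^{(0,1)}=\sum_{j=0}^n f_j(x)f_j'(x),\quad K_n^{(1,1)}=\sum_{j=0}^n f_j'(x)^2,\quad \mathcal K_n(x)=\frac{\sqrt{K_n^{(1,1)}K_n-(K_n^{(0,1)})^2}}{K_n}.$$ Suppose that for some $a>0$, $q\ge 1$ we have $|\phi(s)|\le (1+as^2)^{-q}$ for all $s\in\mathbb R$, and that $\phi$ is three times differentiable with $|\phi''(s)|\le C_2$ and $|\phi'''(s)|\le C_3$ for all $s\in\mathbb R$, where $C_2,C_3>0$ are constants. Then the expected number of real zeros of $P_n$ has a density $\rho_n\ge 0$ on $\{x\in\mathbb R: K_n\ne 0\}$: for every Borel set $S$ contained in this set, the expected number of zeros of $P_n$ in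 $S$ equals $\int_S\rho_n(x)\,dx$; and at every $x$ with $K_n\neq 0$ and $K_n^{(1,1)}K_n-(K_n^{(0,1)})^2\ne 0$ the pair $(P_n(x),P_n'(x))$ has a continuous joint density $D_n(\xi,\eta;x)$ and $\rho_n(x)=\int_{\mathbb R}|\eta|\,D_n(0,\eta;x)\,d\eta<\infty$. This density can be chosen such that for every $x\in\mathbb R$ with $K_n\ne 0$ $$\rho_n(x)\le \mathcal K_n(x)\,\frac1{aq}\left[k_1+C_3k_2+\frac{1}{\sqrt{aq}}\,C_2\,(k_3+C_2k_4)\right],$$ where $$k_1=\frac1\pi\Big(1-\log 2+\frac{\pi\sqrt3+\log 8}{9}\Big)\approx 0.36,\qquad k_2=\frac{\pi\sqrt3+\log 8}{9\pi}\approx 0.27,$$ $$k_3=\frac{1-\log 2}{\sqrt2}\approx 0.22,\qquad k_4=\frac{\sqrt2}{9}(\pi\sqrt3+\log 8)\approx 1.18 .$$ -/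

import Mathlib

open MeasureTheory ProbabilityTheory
open scoped ENNReal

noncomputable section

namespace RandomSum

/-- `K_n(x,x) = ∑ f_j(x)^2` for functions `f_j` that are real on the real line. -/
def K {n : ℕ} (f : Fin (n + 1) → ℂ → ℂ) (x : ℝ) : ℝ :=
  ∑ j, (f j x).re ^ 2

/-- `K_n^{(0,1)}(x,x) = ∑ f_j(x) f_j'(x)`. -/
def K01 {n : ℕ} (f : Fin (n + 1) → ℂ → ℂ) (x : ℝ) : ℝ :=
  ∑ j, (f j x).re * (deriv (f j) x).re

/-- `K_n^{(1,1)}(x,x) = ∑ f_j'(x)^2`. -/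
def K11 {n : ℕ} (f : Fin (n + 1) → ℂ → ℂ) (x : ℝ) : ℝ :=
  ∑ j, (deriv (f j) x).re ^ 2

/-- `𝒦_n(x) = √(K_n^{(1,1)} K_n - (K_n^{(0,1)})^2) / K_n`. -/
def scriptK {n : ℕ} (f : Fin (n + 1) → ℂ → ℂ) (x : ℝ) : ℝ :=
  √(K11 f x * K f x - K01 f x ^ 2) / K f x

/-- The random sum `P_n(z) = ∑ η_k f_k(z)`. -/
def P {Ω : Type*} {n : ℕ} (η : Fin (n + 1) → Ω → ℝ) (f : Fin (n + 1) → ℂ → ℂ)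
    (ω : Ω) (z : ℂ) : ℂ :=
  ∑ k, (η k ω : ℂ) * f k z

/-- The number of real zeros of `P_n` in the set `S ⊆ ℝ`. -/
def zeroCount {Ω : Type*} {n : ℕ} (η : Fin (n + 1) → Ω → ℝ) (f : Fin (n + 1) → ℂ → ℂ)
    (S : Set ℝ) (ω : Ω) : ℝ≥0∞ :=
  ({x : ℝ | x ∈ S ∧ P η f ω x = 0}.encard : ℝ≥0∞)

/-- `D` is the continuous joint probability density of `X` and `Y`. (There is at most one, so
that its values on the null set `{0} × ℝ` are meaningful.) -/
def IsJointDensity {Ω : Type*} [MeasurableSpace Ω] (μ : Measure Ω) (X Y : Ω → ℝ)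
    (D : ℝ × ℝ → ℝ) : Prop :=
  Continuous D ∧ (∀ p, 0 ≤ D p) ∧
    μ.map (fun ω => (X ω, Y ω)) = volume.withDensity (fun p => ENNReal.ofReal (D p))

/-- `ρ` is the density function of the expected number of real zeros of `P_n`.  It is considered
at the points where `K_n(x,x) ≠ 0`; a zero of `K_n(x,x)` is a common zero of all the `f_k`. -/
structure IsRealZeroDensity {Ω : Type*} [MeasurableSpace Ω] (μ : Measure Ω) {n : ℕ}
    (η : Fin (n + 1) → Ω → ℝ) (f : Fin (n + 1) → ℂ → ℂ) (ρ : ℝ → ℝ) : Prop where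
  measurable : Measurable ρ
  nonneg : ∀ x, 0 ≤ ρ x
  /-- The number of zeros in a Borel set is a random variable. -/
  aemeasurable_zeroCount : ∀ S : Set ℝ, MeasurableSet S → (∀ x ∈ S, K f x ≠ 0) →
    AEMeasurable (zeroCount η f S) μ
  /-- `𝔼[N_n(S)] = ∫_S ρ(x) dx`. -/
  lintegral_zeroCount : ∀ S : Set ℝ, MeasurableSet S → (∀ x ∈ S, K f x ≠ 0) →
    ∫⁻ ω, zeroCount η f S ω ∂μ = ∫⁻ x in S, ENNReal.ofReal (ρ x)
  /-- `ρ(x) = ∫ |y| D_n(0,y;x) dy`, with `D_n(·,·;x)` the joint density of `P_n(x)` and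
  `P_n'(x)`, at every point where these two are linearly independent. This fixes `ρ`
  pointwise there and not merely almost everywhere. -/
  kac_rice : ∀ x : ℝ, K f x ≠ 0 → K11 f x * K f x - K01 f x ^ 2 ≠ 0 →
    ∃ D : ℝ × ℝ → ℝ,
      IsJointDensity μ (fun ω => (P η f ω x).re) (fun ω => (deriv (P η f ω) x).re) D ∧
      Integrable (fun y : ℝ => |y| * D (0, y)) ∧
      ρ x = ∫ y : ℝ, |y| * D (0, y)

/-- `k₁ ≈ 0.36`. -/
def k₁ : ℝ :=
  1 / Real.pi * (1 - Real.log 2 + (Real.pi * √3 + Real.log 8) / 9)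

/-- `k₂ ≈ 0.27`. -/
def k₂ : ℝ := 1 / (9 * Real.pi) * (Real.pi * √3 + Real.log 8)

/-- `k₃ ≈ 0.21`. -/
def k₃ : ℝ := 1 / √2 * (1 - Real.log 2)

/-- `k₄ ≈ 1.18`. -/
def k₄ : ℝ := √2 / 9 * (Real.pi * √3 + Real.log 8)

end RandomSum

end

open Filter Topology FourierTransform Set Function

/-! Write b = aq, g_j = f_j on the real line, K = ∑ g_j², and let Δ be the Gram determinant of g and
g'. The proof establishes the simpler bound ρ ≤ √3/√b · √Δ/K = √3/√b · 𝒦 and then checks that the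
stated right-hand side is larger.

Anti-concentration: Bernoulli's inequality gives |φ(s)| ≤ 1/(1 + b s²). This form of bound survives
independent sums: ∑ c_j η_j satisfies it with b|c|² in place of b. By Fourier inversion its density
is then at most 1/(2√b |c|) (`exists_continuous_density_of_norm_charFun_le`,
`measure_sum_mul_mem_le`).

Kac–Rice: where g_k(x) ≠ 0, the equation ∑ v_j g_j(x) = 0 can be solved for v_k. Trading the
coordinate v_k for the position x of a zero is a map between spaces of equal dimension whose fibres
are the zeros, so the area formula counts them (`area_formula`, `kacRice_of_ne_zero`). The intensity
appears as a `sliceIntegral`: the mean of |∑ v_j g'_j| on the slice ∑ v_j g_j = 0, weighted by the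
density there. If Δ ≠ 0, it equals ∫ |y| D(0, y) dy (`exists_joint_density`).

Bounding the slice integral (`sliceIntegral_abs_le`): on the slice, g' may be replaced by c = g' - τ
g for any τ. If c lives on a set A of indices, the part of ∑ v_j g_j outside A is independent of ∑
v_j c_j. So the mean is at most |c| times the density bound for that part. If one g_m² is at least
K/3, τ is chosen to kill the coordinate m and A is everything else. Otherwise the indices split into
two halves each carrying at least K/3 of K, and c is cut along them.

Comparison: variance one forces b ≤ 9/17 and C₂ ≥ |φ''(0)| = 1, and k₄ ≥ 1, so the k₄ term alone is
large enough (`sqrt_three_div_sqrt_le`). -/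

/-! ### Fourier inversion and bounded densities -/

lemma fourier_gaussian_regularization {ν : Measure ℝ} [IsProbabilityMeasure ν] {ε : ℝ}
    (hε : 0 < ε) (x : ℝ) :
    ∫ s : ℝ, Complex.exp (-2 * Real.pi * x * s * Complex.I) *
        (Complex.exp (-Real.pi * ε * s ^ 2) * charFun ν (2 * Real.pi * s))
      = ((∫ y, 1 / √ε * Real.exp (-(Real.pi / ε) * (x - y) ^ 2) ∂ν : ℝ) : ℂ) := by
  have hre : (0 : ℝ) < (ε : ℂ).re := by simpa using hε
  have key : ∀ t : ℝ, ∫ s : ℝ, Complex.exp (-2 * Real.pi * t * s * Complex.I) *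
      Complex.exp (-Real.pi * ε * s ^ 2) =
      ((1 / √ε * Real.exp (-(Real.pi / ε) * t ^ 2) : ℝ) : ℂ) := by
    intro t
    have h := congrFun (fourier_gaussian_pi hre) t
    rw [Real.fourier_eq'] at h
    have e1 : ((ε : ℂ)) ^ (1 / 2 : ℂ) = ((√ε : ℝ) : ℂ) := by
      rw [Real.sqrt_eq_rpow, Complex.ofReal_cpow hε.le]; norm_num
    rw [e1] at h
    push_cast at h ⊢
    convert h using 1
    · congr 1; ext s
      simp only [smul_eq_mul, RCLike.inner_apply, conj_trivial]
      congr 2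
      push_cast; ring
    · congr 2; ring
  have hint : Integrable (fun z : ℝ × ℝ => Complex.exp (-2 * Real.pi * x * z.1 * Complex.I) *
        (Complex.exp (-Real.pi * ε * z.1 ^ 2) *
          Complex.exp ((2 * Real.pi * z.1 : ℝ) * z.2 * Complex.I))) (volume.prod ν) := by
    have h1 : Integrable (fun s : ℝ => Real.exp (-(Real.pi * ε) * s ^ 2)) :=
      integrable_exp_neg_mul_sq (by positivity)
    have h2 := h1.mul_prod (ν := ν) (integrable_const (1 : ℝ))
    refine h2.mono (by fun_prop) (Eventually.of_forall fun z => ?_)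
    simp only [norm_mul, Complex.norm_exp]
    simp [sq]
  calc _ = ∫ s : ℝ, ∫ y, Complex.exp (-2 * Real.pi * x * s * Complex.I) *
        (Complex.exp (-Real.pi * ε * s ^ 2) *
          Complex.exp ((2 * Real.pi * s : ℝ) * y * Complex.I)) ∂ν := by
        congr 1; ext s
        rw [integral_const_mul, integral_const_mul, charFun_apply_real]
    _ = ∫ y, (∫ s : ℝ, Complex.exp (-2 * Real.pi * x * s * Complex.I) *
        (Complex.exp (-Real.pi * ε * s ^ 2) *
          Complex.exp ((2 * Real.pi * s : ℝ) * y * Complex.I))) ∂ν :=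
        integral_integral_swap hint
    _ = ∫ y, ((1 / √ε * Real.exp (-(Real.pi / ε) * (x - y) ^ 2) : ℝ) : ℂ) ∂ν := by
        congr 1; ext y
        rw [← key (x - y)]
        congr 1; ext s
        rw [← Complex.exp_add, ← Complex.exp_add, ← Complex.exp_add]
        congr 1
        push_cast; ring
    _ = _ := integral_ofReal

/-- Tonelli and the unit mass of the Gaussian. Fatou carries the bound over to the limit ε → 0,
where it makes the candidate density integrable. -/
lemma lintegral_gaussian_kernel_le {ν : Measure ℝ} [IsProbabilityMeasure ν] {ε : ℝ}
    (hε : 0 < ε) :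
    ∫⁻ x : ℝ, ENNReal.ofReal (∫ y, 1 / √ε * Real.exp (-(Real.pi / ε) * (x - y) ^ 2) ∂ν) ≤ 1 := by
  have hg : ∫⁻ x : ℝ, ENNReal.ofReal (1 / √ε * Real.exp (-(Real.pi / ε) * x ^ 2)) = 1 := by
    rw [← ofReal_integral_eq_lintegral_ofReal
      ((integrable_exp_neg_mul_sq (by positivity)).const_mul _)
      (Eventually.of_forall fun x => by positivity), integral_const_mul, integral_gaussian]
    have : Real.pi / (Real.pi / ε) = ε := by field_simp
    rw [this, one_div, inv_mul_cancel₀ (by positivity), ENNReal.ofReal_one]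
  have hint : ∀ x : ℝ, Integrable (fun y => 1 / √ε * Real.exp (-(Real.pi / ε) * (x - y) ^ 2)) ν := by
    intro x
    refine (integrable_const (1 / √ε)).mono (by fun_prop) (Eventually.of_forall fun y => ?_)
    rw [norm_mul, Real.norm_eq_abs (Real.exp _), abs_of_pos (Real.exp_pos _)]
    refine mul_le_of_le_one_right (norm_nonneg _) (Real.exp_le_one_iff.2 ?_)
    have : 0 < Real.pi / ε := by positivity
    nlinarith [sq_nonneg (x - y)]
  calc _ = ∫⁻ x : ℝ, ∫⁻ y, ENNReal.ofReal (1 / √ε * Real.exp (-(Real.pi / ε) * (x - y) ^ 2)) ∂ν := by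
        congr 1; ext x
        exact ofReal_integral_eq_lintegral_ofReal (hint x)
          (Eventually.of_forall fun y => by positivity)
    _ = ∫⁻ y, (∫⁻ x : ℝ, ENNReal.ofReal (1 / √ε * Real.exp (-(Real.pi / ε) * (x - y) ^ 2))) ∂ν :=
        lintegral_lintegral_swap (by fun_prop)
    _ = ∫⁻ y, 1 ∂ν := by
        congr 1; ext y
        rw [lintegral_sub_right_eq_self
          (fun x => ENNReal.ofReal (1 / √ε * Real.exp (-(Real.pi / ε) * x ^ 2))) y, hg]
    _ ≤ 1 := by simp

/-- A probability measure on `ℝ` with integrable characteristic function has a continuous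
density, bounded by the `L¹` norm of the characteristic function. -/
theorem exists_continuous_density_of_integrable_charFun (ν : Measure ℝ) [IsProbabilityMeasure ν]
    (h : Integrable (charFun ν)) :
    ∃ p : ℝ → ℝ, Continuous p ∧ (∀ x, 0 ≤ p x) ∧
      (∀ x, p x ≤ 1 / (2 * Real.pi) * ∫ s, ‖charFun ν s‖) ∧
      ν = volume.withDensity (fun x => ENNReal.ofReal (p x)) := by
  set f : ℝ → ℂ := fun s => charFun ν (2 * Real.pi * s) with hf
  have hπ : (2 * Real.pi) ≠ 0 := by positivity
  have hfc : Continuous f := continuous_charFun.comp (by fun_prop)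
  have hfi : Integrable f := h.comp_mul_left' hπ
  have hpc : Continuous (𝓕 f) := by
    have := VectorFourier.fourierIntegral_continuous (μ := (volume : Measure ℝ))
      Real.continuous_fourierChar (L := innerₗ ℝ) (by exact continuous_inner) hfi
    exact this
  have hreg : ∀ (ε : ℝ) (x : ℝ), 0 < ε → ∫ s : ℝ, Complex.exp (-2 * Real.pi * x * s * Complex.I) *
        (Complex.exp (-Real.pi * ε * s ^ 2) * f s)
      = ((∫ y, 1 / √ε * Real.exp (-(Real.pi / ε) * (x - y) ^ 2) ∂ν : ℝ) : ℂ) :=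
    fun ε x hε => fourier_gaussian_regularization hε x
  -- Gaussian parameters tending to 0: the regularized Fourier integrals converge to `𝓕 f` and are
  -- real and nonnegative, hence so is `𝓕 f`.
  set u : ℕ → ℝ := fun m => 1 / ((m : ℝ) + 1) with hu
  have hupos : ∀ m, 0 < u m := fun m => by positivity
  have hu0 : Tendsto u atTop (𝓝 0) := tendsto_one_div_add_atTop_nhds_zero_nat
  have hlim : ∀ x : ℝ, Tendsto (fun m =>
      ((∫ y, 1 / √(u m) * Real.exp (-(Real.pi / (u m)) * (x - y) ^ 2) ∂ν : ℝ) : ℂ)) atTop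
      (𝓝 (𝓕 f x)) := by
    intro x
    simp_rw [← hreg _ x (hupos _)]
    rw [Real.fourier_eq']
    refine tendsto_integral_of_dominated_convergence (fun s => ‖f s‖) ?_ hfi.norm ?_ ?_
    · intro m
      exact (by fun_prop : Continuous _).aestronglyMeasurable
    · intro m
      refine Eventually.of_forall fun s => ?_
      rw [norm_mul, norm_mul, Complex.norm_exp, Complex.norm_exp]
      have e1 : (-2 * (Real.pi : ℂ) * x * s * Complex.I).re = 0 := by simp
      have e2 : (-(Real.pi : ℂ) * (u m : ℝ) * (s : ℂ) ^ 2).re = -(Real.pi * u m * s ^ 2) := by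
        rw [show (-(Real.pi : ℂ) * (u m : ℝ) * (s : ℂ) ^ 2)
          = ((-(Real.pi * u m * s ^ 2) : ℝ) : ℂ) by push_cast; ring]
        exact Complex.ofReal_re _
      rw [e1, e2, Real.exp_zero, one_mul]
      refine mul_le_of_le_one_left (norm_nonneg _) (Real.exp_le_one_iff.2 ?_)
      have := hupos m
      have := Real.pi_pos
      simp only [Left.neg_nonpos_iff]
      positivity
    · refine Eventually.of_forall fun s => ?_
      have h1 : Tendsto (fun m => Complex.exp (-2 * Real.pi * x * s * Complex.I) *
        (Complex.exp (-Real.pi * (u m : ℝ) * s ^ 2) * f s)) atTop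
        (𝓝 (Complex.exp (-2 * Real.pi * x * s * Complex.I) *
        (Complex.exp (-Real.pi * ((0 : ℝ) : ℂ) * s ^ 2) * f s))) := by
        have hc : Continuous (fun e : ℝ => Complex.exp (-2 * Real.pi * x * s * Complex.I) *
          (Complex.exp (-Real.pi * (e : ℝ) * s ^ 2) * f s)) := by fun_prop
        exact (hc.tendsto 0).comp hu0
      convert h1 using 2
      simp only [smul_eq_mul, RCLike.inner_apply, conj_trivial, Complex.ofReal_zero, mul_zero,
        zero_mul, Complex.exp_zero, one_mul]
      congr 2
      push_cast; ring
  set p : ℝ → ℝ := fun x => (𝓕 f x).re with hp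
  have hlimre : ∀ x : ℝ, Tendsto (fun m =>
      ∫ y, 1 / √(u m) * Real.exp (-(Real.pi / (u m)) * (x - y) ^ 2) ∂ν) atTop (𝓝 (p x)) := by
    intro x
    have := (Complex.continuous_re.tendsto _).comp (hlim x)
    simpa [Function.comp_def] using this
  have him : ∀ x, (𝓕 f x) = (p x : ℂ) := by
    intro x
    have := (Complex.continuous_ofReal.tendsto _).comp (hlimre x)
    exact tendsto_nhds_unique (hlim x) this
  have hp0 : ∀ x, 0 ≤ p x := fun x => ge_of_tendsto (hlimre x) (Eventually.of_forall fun m =>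
    integral_nonneg fun y => by positivity)
  have hpcont : Continuous p := Complex.continuous_re.comp hpc
  -- Fatou gives mass at most one. This suffices: integrability of `p` is all that Fourier inversion
  -- needs, and equality follows afterwards.
  have hplint : ∫⁻ x, ENNReal.ofReal (p x) ≤ 1 := by
    have hF : ∀ x, ENNReal.ofReal (p x) = liminf (fun m => ENNReal.ofReal
      (∫ y, 1 / √(u m) * Real.exp (-(Real.pi / (u m)) * (x - y) ^ 2) ∂ν)) atTop := fun x =>
      ((ENNReal.continuous_ofReal.tendsto _).comp (hlimre x)).liminf_eq.symm
    simp_rw [hF]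
    refine (lintegral_liminf_le fun m => ?_).trans ?_
    · refine ENNReal.measurable_ofReal.comp ?_
      refine StronglyMeasurable.measurable ?_
      refine StronglyMeasurable.integral_prod_right
        (f := fun x y => 1 / √(u m) * Real.exp (-(Real.pi / (u m)) * (x - y) ^ 2)) ?_
      exact Continuous.stronglyMeasurable (by fun_prop)
    · refine liminf_le_of_le (by isBoundedDefault) fun b hb => ?_
      obtain ⟨m, hm⟩ := hb.exists
      exact hm.trans (lintegral_gaussian_kernel_le (hupos m))
  have hpint : Integrable p :=
    ⟨hpcont.aestronglyMeasurable, by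
      rw [hasFiniteIntegral_iff_ofReal (Eventually.of_forall hp0)]
      exact hplint.trans_lt ENNReal.one_lt_top⟩
  have hFint : Integrable (𝓕 f) := by
    rw [show 𝓕 f = fun x => (p x : ℂ) from funext him]
    exact hpint.ofReal
  have hinv := hfc.fourierInv_fourier_eq hfi hFint
  refine ⟨p, hpcont, hp0, fun x => ?_, ?_⟩
  · calc p x ≤ ‖𝓕 f x‖ := Complex.re_le_norm _
      _ ≤ ∫ s, ‖f s‖ := by
        rw [Real.fourier_eq]
        refine (norm_integral_le_integral_norm _).trans (le_of_eq ?_)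
        congr 1; ext s
        exact Circle.norm_smul _ _
      _ = _ := by
        have := Measure.integral_comp_mul_left (fun s => ‖charFun ν s‖) (2 * Real.pi)
        simp only [hf]
        rw [this, abs_of_pos (by positivity), smul_eq_mul, one_div]
  · have hfin : IsFiniteMeasure (volume.withDensity fun x => ENNReal.ofReal (p x)) :=
      isFiniteMeasure_withDensity (ne_top_of_le_ne_top ENNReal.one_ne_top hplint)
    -- By inversion, `p` has the characteristic function of `ν`; the factor 2π converts between the
    -- two Fourier conventions.
    refine Measure.ext_of_charFun ?_
    ext t
    have h1 := congrFun hinv (t / (2 * Real.pi))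
    rw [Real.fourierInv_eq'] at h1
    have h2 : f (t / (2 * Real.pi)) = charFun ν t := by
      simp only [hf]; congr 1; field_simp
    rw [← h2, ← h1, charFun_apply_real]
    rw [integral_withDensity_eq_integral_toReal_smul (by fun_prop)
      (Eventually.of_forall fun x => ENNReal.ofReal_lt_top)]
    congr 1; ext x
    rw [ENNReal.toReal_ofReal (hp0 x), him x]
    simp only [smul_eq_mul, RCLike.inner_apply, conj_trivial, Complex.real_smul]
    rw [mul_comm]
    congr 2
    push_cast
    have : (Real.pi : ℂ) ≠ 0 := by exact_mod_cast Real.pi_ne_zero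
    field_simp

lemma integrable_one_div_one_add_mul_sq {b : ℝ} (hb : 0 < b) :
    Integrable (fun s : ℝ => 1 / (1 + b * s ^ 2)) := by
  have h := integrable_inv_one_add_sq.comp_mul_left' (R := √b) (by positivity)
  refine h.congr (Eventually.of_forall fun s => ?_)
  simp [mul_pow, Real.sq_sqrt hb.le]

lemma integral_one_div_one_add_mul_sq {b : ℝ} (hb : 0 < b) :
    ∫ s : ℝ, 1 / (1 + b * s ^ 2) = Real.pi / √b := by
  have h := Measure.integral_comp_mul_left (fun s : ℝ => (1 + s ^ 2)⁻¹) (√b)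
  rw [integral_univ_inv_one_add_sq, abs_of_pos (by positivity), smul_eq_mul] at h
  rw [div_eq_inv_mul, ← h]
  congr 1; ext s
  simp [mul_pow, Real.sq_sqrt hb.le]

/-- Quantitative form: a characteristic function dominated by `1 / (1 + b s²)`. -/
theorem exists_continuous_density_of_norm_charFun_le (ν : Measure ℝ) [IsProbabilityMeasure ν]
    {b : ℝ} (hb : 0 < b) (h : ∀ s, ‖charFun ν s‖ ≤ 1 / (1 + b * s ^ 2)) :
    ∃ p : ℝ → ℝ, Continuous p ∧ (∀ x, 0 ≤ p x) ∧ (∀ x, p x ≤ 1 / (2 * √b)) ∧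
      ν = volume.withDensity (fun x => ENNReal.ofReal (p x)) := by
  have hi : Integrable (charFun ν) :=
    (integrable_one_div_one_add_mul_sq hb).mono' measurable_charFun.aestronglyMeasurable
      (Eventually.of_forall h)
  obtain ⟨p, h1, h2, h3, h4⟩ := exists_continuous_density_of_integrable_charFun ν hi
  refine ⟨p, h1, h2, fun x => (h3 x).trans ?_, h4⟩
  calc _ ≤ 1 / (2 * Real.pi) * ∫ s : ℝ, 1 / (1 + b * s ^ 2) := by
        refine mul_le_mul_of_nonneg_left ?_ (by positivity)
        exact integral_mono hi.norm (integrable_one_div_one_add_mul_sq hb) h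
    _ = _ := by
        rw [integral_one_div_one_add_mul_sq hb]
        have := Real.pi_pos
        field_simp

/-! ### The area formula in equal dimensions -/

lemma exists_injOn_nhds_of_det_ne_zero {E : Type*} [NormedAddCommGroup E] [NormedSpace ℝ E]
    [FiniteDimensional ℝ E] {T : E → E} {T' : E →L[ℝ] E} {x : E}
    (h : HasStrictFDerivAt T T' x) (hdet : T'.det ≠ 0) : ∃ U ∈ 𝓝 x, InjOn T U := by
  have : CompleteSpace E := FiniteDimensional.complete ℝ E
  have h' : HasStrictFDerivAt T
      ((T'.toContinuousLinearEquivOfDetNeZero hdet : E ≃L[ℝ] E) : E →L[ℝ] E) x := by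
    simpa using h
  exact ⟨(h'.toOpenPartialHomeomorph T).source,
    (h'.toOpenPartialHomeomorph T).open_source.mem_nhds h'.mem_toOpenPartialHomeomorph_source,
    (h'.toOpenPartialHomeomorph T).injOn⟩

/-- On the set where the Jacobian does not vanish, a strictly differentiable map is injective on
each piece of a countable measurable partition. -/
lemma exists_measurable_partition_injOn {E : Type*} [NormedAddCommGroup E] [NormedSpace ℝ E]
    [FiniteDimensional ℝ E] [MeasurableSpace E] [BorelSpace E]
    {T : E → E} {T' : E → E →L[ℝ] E} {s : Set E} (hs : MeasurableSet s)
    (hT : ∀ x ∈ s, HasStrictFDerivAt T (T' x) x) (hdet : ∀ x ∈ s, (T' x).det ≠ 0) :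
    ∃ t : ℕ → Set E, (∀ i, MeasurableSet (t i)) ∧ Pairwise (Function.onFun Disjoint t) ∧
      (⋃ i, t i = s) ∧ ∀ i, InjOn T (t i) := by
  have : ProperSpace E := FiniteDimensional.proper ℝ E
  have : SecondCountableTopology E := inferInstance
  classical
  obtain ⟨b, hb⟩ := TopologicalSpace.exists_seq_basis E
  set U : ℕ → Set E := fun i => if InjOn T (b i) then b i else ∅ with hU
  have hUm : ∀ i, MeasurableSet (U i) := by
    intro i
    simp only [hU]
    split_ifs
    · exact (hb.isOpen (mem_range_self i)).measurableSet
    · exact MeasurableSet.empty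
  have hUi : ∀ i, InjOn T (U i) := by
    intro i
    simp only [hU]
    split_ifs with h
    · exact h
    · exact injOn_empty T
  have hcov : s ⊆ ⋃ i, U i := by
    intro x hx
    obtain ⟨V, hV, hVi⟩ := exists_injOn_nhds_of_det_ne_zero (hT x hx) (hdet x hx)
    obtain ⟨_, ⟨i, rfl⟩, hxi, hiV⟩ := hb.mem_nhds_iff.1 hV
    refine mem_iUnion.2 ⟨i, ?_⟩
    simp only [hU]
    rw [if_pos (hVi.mono hiV)]
    exact hxi
  refine ⟨fun i => s ∩ disjointed U i, fun i => hs.inter (MeasurableSet.disjointed hUm i), ?_, ?_,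
    fun i => (hUi i).mono (inter_subset_right.trans (disjointed_subset U i))⟩
  · intro i j hij
    exact ((disjoint_disjointed U) hij).mono inter_subset_right inter_subset_right
  · rw [← inter_iUnion, iUnion_disjointed, inter_eq_left]
    exact hcov

lemma encard_inter_preimage_singleton_of_injOn {α β : Type*} {T : α → β} {t : Set α}
    (h : InjOn T t) (y : β) :
    ((t ∩ T ⁻¹' {y}).encard : ℝ≥0∞) = (T '' t).indicator 1 y := by
  classical
  by_cases hy : y ∈ T '' t
  · rw [indicator_of_mem hy]
    obtain ⟨x, hx, rfl⟩ := hy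
    have : t ∩ T ⁻¹' {T x} = {x} := by
      ext z
      constructor
      · rintro ⟨hz, hz'⟩
        exact h hz hx hz'
      · rintro rfl
        exact ⟨hx, rfl⟩
    simp [this]
  · rw [indicator_of_notMem hy]
    have : t ∩ T ⁻¹' {y} = ∅ := by
      ext z
      simp only [mem_inter_iff, mem_preimage, mem_singleton_iff, mem_empty_iff_false, iff_false,
        not_and]
      rintro hz rfl
      exact hy ⟨z, hz, rfl⟩
    simp [this]

/-- Countable additivity of the counting measure for the σ-algebra of all subsets. -/
lemma encard_iUnion_eq_tsum {α κ : Type*} [Countable κ] {A : κ → Set α}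
    (h : Pairwise (Function.onFun Disjoint A)) :
    ((⋃ i, A i).encard : ℝ≥0∞) = ∑' i, ((A i).encard : ℝ≥0∞) := by
  let _ : MeasurableSpace α := ⊤
  have hm : ∀ s : Set α, MeasurableSet s := fun _ => MeasurableSpace.measurableSet_top
  have := measure_iUnion (μ := Measure.count) h (fun i => hm _)
  rw [Measure.count_apply (hm _)] at this
  rw [this]
  exact tsum_congr fun i => Measure.count_apply (hm _)

/-- The area formula for strictly differentiable maps between spaces of equal dimension, together
with the measurability of the multiplicity function. -/
theorem area_formula {E : Type*} [NormedAddCommGroup E] [NormedSpace ℝ E]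
    [FiniteDimensional ℝ E] [MeasurableSpace E] [BorelSpace E] (μ : Measure E)
    [μ.IsAddHaarMeasure] {T : E → E} {T' : E → E →L[ℝ] E} {s : Set E} (hs : MeasurableSet s)
    (hT : ∀ x ∈ s, HasStrictFDerivAt T (T' x) x)
    (hdet : MeasurableSet {x ∈ s | (T' x).det = 0}) :
    AEMeasurable (fun y => ((s ∩ T ⁻¹' {y}).encard : ℝ≥0∞)) μ ∧
      ∀ W : E → ℝ≥0∞, Measurable W →
        ∫⁻ y, ((s ∩ T ⁻¹' {y}).encard : ℝ≥0∞) * W y ∂μ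
          = ∫⁻ x in s, ENNReal.ofReal |(T' x).det| * W (T x) ∂μ := by
  set s₀ : Set E := {x ∈ s | (T' x).det = 0} with hs₀
  have hs₀s : s₀ ⊆ s := fun x hx => hx.1
  obtain ⟨t, htm, htd, htU, hti⟩ := exists_measurable_partition_injOn (hs.diff hdet)
    (fun x hx => hT x hx.1) (fun x hx h0 => hx.2 ⟨hx.1, h0⟩)
  have hts : ∀ i, t i ⊆ s := fun i => (subset_iUnion t i).trans (htU.subset.trans sdiff_subset)
  have hder : ∀ i, ∀ x ∈ t i, HasFDerivWithinAt T (T' x) (t i) x := fun i x hx =>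
    (hT x (hts i hx)).hasFDerivAt.hasFDerivWithinAt
  have him : ∀ i, MeasurableSet (T '' t i) := fun i =>
    measurable_image_of_fderivWithin (htm i) (hder i) (hti i)
  -- Critical values form a null set (the easy, equidimensional case of Sard's theorem).
  have hnull : μ (T '' s₀) = 0 := addHaar_image_eq_zero_of_det_fderivWithin_eq_zero μ
    (f' := T') (fun x hx => (hT x (hs₀s hx)).hasFDerivAt.hasFDerivWithinAt) fun x hx => hx.2
  -- Away from critical values every preimage lies in some injectivity piece, and each piece
  -- contains at most one.
  have hcount : ∀ᵐ y ∂μ, ((s ∩ T ⁻¹' {y}).encard : ℝ≥0∞) = ∑' i, (T '' t i).indicator 1 y := by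
    have : ∀ᵐ y ∂μ, y ∉ T '' s₀ := measure_eq_zero_iff_ae_notMem.1 hnull
    filter_upwards [this] with y hy
    have h1 : s ∩ T ⁻¹' {y} = ⋃ i, (t i ∩ T ⁻¹' {y}) := by
      rw [← iUnion_inter, htU]
      ext x
      constructor
      · rintro ⟨hx, rfl⟩
        exact ⟨⟨hx, fun h => hy ⟨x, h, rfl⟩⟩, rfl⟩
      · rintro ⟨hx, hxy⟩
        exact ⟨hx.1, hxy⟩
    rw [h1, encard_iUnion_eq_tsum]
    · exact tsum_congr fun i => encard_inter_preimage_singleton_of_injOn (hti i) y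
    · exact fun i j hij => (htd hij).mono inter_subset_left inter_subset_left
  have hmeas : Measurable fun y => ∑' i, (T '' t i).indicator (1 : E → ℝ≥0∞) y :=
    Measurable.tsum fun i => measurable_one.indicator (him i)
  refine ⟨hmeas.aemeasurable.congr (hcount.mono fun y hy => hy.symm), fun W hW => ?_⟩
  have hzero : ∫⁻ x in s₀, ENNReal.ofReal |(T' x).det| * W (T x) ∂μ = 0 := by
    rw [setLIntegral_congr_fun (g := fun _ => 0) hdet]
    · simp
    · intro x hx
      simp [hx.2]
  calc _ = ∫⁻ y, ∑' i, (T '' t i).indicator 1 y * W y ∂μ := by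
        refine lintegral_congr_ae (hcount.mono fun y hy => ?_)
        simp only [hy]
        rw [ENNReal.tsum_mul_right]
    _ = ∑' i, ∫⁻ y in T '' t i, W y ∂μ := by
        rw [lintegral_tsum (f := fun i y => (T '' t i).indicator 1 y * W y)
          fun i => ((measurable_one.indicator (him i)).mul hW).aemeasurable]
        refine tsum_congr fun i => ?_
        rw [← lintegral_indicator (him i)]
        congr 1; ext y
        by_cases hy : y ∈ T '' t i <;> simp [hy]
    _ = ∑' i, ∫⁻ x in t i, ENNReal.ofReal |(T' x).det| * W (T x) ∂μ :=
        tsum_congr fun i =>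
          lintegral_image_eq_lintegral_abs_det_fderiv_mul μ (htm i) (hder i) (hti i) W
    _ = ∫⁻ x in s \ s₀, ENNReal.ofReal |(T' x).det| * W (T x) ∂μ := by
        rw [← lintegral_iUnion htm htd, htU]
    _ = _ := by
        rw [← lintegral_inter_add_sdiff _ s hdet, inter_eq_self_of_subset_right hs₀s, hzero,
          zero_add]

/-! ### Resampling a coordinate of a product measure -/

lemma lintegral_eq_lintegral_density_mul {ν : Measure ℝ} {p : ℝ → ℝ} (hp : Measurable p)
    (hν : ν = volume.withDensity fun x => ENNReal.ofReal (p x)) {G : ℝ → ℝ≥0∞}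
    (hG : Measurable G) : ∫⁻ t, G t ∂ν = ∫⁻ t, ENNReal.ofReal (p t) * G t := by
  rw [hν, lintegral_withDensity_eq_lintegral_mul _ (by fun_prop) hG]
  rfl

section Resampling

variable {ι : Type*} [DecidableEq ι]

lemma measurable_update_prod (k : ι) :
    Measurable (fun z : ℝ × (ι → ℝ) => update z.2 k z.1) := by
  refine measurable_pi_iff.2 fun j => ?_
  rcases eq_or_ne j k with rfl | h
  · simpa using measurable_fst
  · simp only [update_of_ne h]
    exact (measurable_pi_apply j).comp measurable_snd

variable [Fintype ι]

/-- Resampling one coordinate of a product measure. -/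
lemma pi_eq_map_update (m : ι → Measure ℝ) [∀ i, SigmaFinite (m i)] (ν : Measure ℝ)
    [IsProbabilityMeasure ν] (k : ι) [∀ i, SigmaFinite (update m k ν i)] :
    Measure.pi m = ((m k).prod (Measure.pi (update m k ν))).map
      (fun z => update z.2 k z.1) := by
  refine Measure.pi_eq fun s hs => ?_
  rw [Measure.map_apply (measurable_update_prod k) (MeasurableSet.univ_pi hs)]
  have h1 : (fun z : ℝ × (ι → ℝ) => update z.2 k z.1) ⁻¹' (pi univ s)
      = s k ×ˢ pi univ (update s k univ) := by
    ext ⟨t, v⟩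
    simp only [mem_preimage, Set.mem_pi, mem_univ, forall_const, mem_prod]
    constructor
    · intro h
      refine ⟨by simpa using h k, fun j => ?_⟩
      rcases eq_or_ne j k with rfl | hj
      · simp
      · simpa [update_of_ne hj] using h j
    · rintro ⟨h, h'⟩ j
      rcases eq_or_ne j k with rfl | hj
      · simpa using h
      · simpa [update_of_ne hj] using h' j
  rw [h1, Measure.prod_prod, Measure.pi_pi, ← Finset.mul_prod_erase _ _ (Finset.mem_univ k),
    ← Finset.mul_prod_erase Finset.univ (fun i => m i (s i)) (Finset.mem_univ k)]
  simp only [update_self, measure_univ, one_mul]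
  congr 1
  refine Finset.prod_congr rfl fun j hj => ?_
  have := Finset.ne_of_mem_erase hj
  simp [update_of_ne this]

lemma lintegral_pi_eq_lintegral_update (m : ι → Measure ℝ) [∀ i, SigmaFinite (m i)]
    (ν : Measure ℝ) [IsProbabilityMeasure ν] (k : ι) [∀ i, SigmaFinite (update m k ν i)]
    {F : (ι → ℝ) → ℝ≥0∞} (hF : Measurable F) :
    ∫⁻ v, F v ∂Measure.pi m
      = ∫⁻ t, (∫⁻ v, F (update v k t) ∂Measure.pi (update m k ν)) ∂(m k) := by
  rw [pi_eq_map_update m ν k, lintegral_map hF (measurable_update_prod k),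
    lintegral_prod (fun z : ℝ × (ι → ℝ) => F (update z.2 k z.1))
      (hF.comp (measurable_update_prod k)).aemeasurable]

variable {ν : Measure ℝ} [IsProbabilityMeasure ν]

/-- An independent copy of one coordinate leaves the law unchanged. This conditions on the other
coordinates while keeping the full index set. -/
lemma lintegral_pi_resample (k : ι) {F : (ι → ℝ) → ℝ≥0∞} (hF : Measurable F) :
    ∫⁻ v, F v ∂Measure.pi (fun _ : ι => ν)
      = ∫⁻ v, (∫⁻ t, F (update v k t) ∂ν) ∂Measure.pi (fun _ : ι => ν) := by
  have hu : update (fun _ : ι => ν) k ν = fun _ => ν := update_eq_self k (fun _ : ι => ν)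
  have : ∀ i, SigmaFinite (update (fun _ : ι => ν) k ν i) := by
    rw [hu]; infer_instance
  rw [lintegral_pi_eq_lintegral_update (fun _ => ν) ν k hF, lintegral_lintegral_swap]
  · congr 1
    ext s
    congr 2
  · exact (hF.comp (measurable_update_prod k)).aemeasurable

instance sigmaFinite_ite_volume (s : Finset ι) (i : ι) :
    SigmaFinite (if i ∈ s then ν else (volume : Measure ℝ)) := by
  split_ifs <;> infer_instance

variable {p : ℝ → ℝ}

/-- A product in which the factors indexed by `s` have density `p` and the others are Lebesgue. -/
lemma pi_ite_eq_withDensity (hp : Measurable p)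
    (hν : ν = volume.withDensity fun x => ENNReal.ofReal (p x)) (s : Finset ι) :
    Measure.pi (fun i => if i ∈ s then ν else (volume : Measure ℝ))
      = (volume : Measure (ι → ℝ)).withDensity (fun v => ∏ j ∈ s, ENNReal.ofReal (p (v j))) := by
  induction s using Finset.induction_on with
  | empty => simp [volume_pi]
  | insert k s hk ih =>
    have hu : ∀ s' : Finset ι, update (fun i => if i ∈ s' then ν else (volume : Measure ℝ)) k ν
        = fun i => if i ∈ insert k s' then ν else volume := by
      intro s'
      ext1 i
      rcases eq_or_ne i k with rfl | hi
      · simp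
      · simp [hi]
    have i1 : ∀ s' : Finset ι, ∀ i, SigmaFinite
        (update (fun i => if i ∈ s' then ν else (volume : Measure ℝ)) k ν i) := by
      intro s'
      rw [hu]
      infer_instance
    have hd : Measurable fun v : ι → ℝ => ∏ j ∈ s, ENNReal.ofReal (p (v j)) := by fun_prop
    have hd' : Measurable fun v : ι → ℝ => ENNReal.ofReal (p (v k)) := by fun_prop
    simp_rw [Finset.prod_insert hk]
    have : (fun v : ι → ℝ => ENNReal.ofReal (p (v k)) * ∏ j ∈ s, ENNReal.ofReal (p (v j)))
      = (fun v : ι → ℝ => ∏ j ∈ s, ENNReal.ofReal (p (v j))) *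
        fun v => ENNReal.ofReal (p (v k)) := by
      ext v; simp [mul_comm]
    rw [this, withDensity_mul _ hd hd', ← ih]
    refine Measure.ext_of_lintegral _ fun F hF => ?_
    -- Both sides are disintegrated along the coordinate `k`. The discarded coordinate gets law `ν`
    -- in both, so only p(t) dt and ν(dt) remain to be compared.
    rw [lintegral_withDensity_eq_lintegral_mul _ hd' hF,
      lintegral_pi_eq_lintegral_update _ ν k (hd'.mul hF),
      lintegral_pi_eq_lintegral_update _ ν k hF]
    simp only [Finset.mem_insert_self, if_true, if_neg hk, Pi.mul_apply, update_self]
    have hm : Measurable fun z : ℝ × (ι → ℝ) => F (update z.2 k z.1) :=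
      hF.comp (measurable_update_prod k)
    rw [lintegral_eq_lintegral_density_mul hp hν hm.lintegral_prod_right', hu, hu,
      Finset.insert_idem]
    refine lintegral_congr fun t => ?_
    rw [lintegral_const_mul _ (by exact hm.comp measurable_prodMk_left)]
end Resampling

/-! ### Slicing a product measure by a linear form -/

lemma lintegral_comp_mul_add {c : ℝ} (hc : c ≠ 0) (r : ℝ) {G : ℝ → ℝ≥0∞} (hG : Measurable G) :
    ∫⁻ t, G (c * t + r) = ENNReal.ofReal |c|⁻¹ * ∫⁻ y, G y := by
  calc _ = ∫⁻ y, G (y + r) ∂(Measure.map (c * ·) volume) := by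
        rw [lintegral_map (f := fun y => G (y + r)) (hG.comp (measurable_id.add_const r))
          (measurable_const_mul c)]
    _ = _ := by
        rw [Real.map_volume_mul_left hc, lintegral_smul_measure, lintegral_add_right_eq_self,
          abs_inv, smul_eq_mul]

section Slicing

variable {ι : Type*} [Fintype ι]

/-- The value of the `k`-th coordinate that puts `v` on the hyperplane `∑ v_j c_j = y`. -/
noncomputable def slicePoint (c : ι → ℝ) (k : ι) (y : ℝ) (v : ι → ℝ) : ℝ :=
  v k + (y - ∑ j, v j * c j) / c k

@[fun_prop]
lemma continuous_slicePoint (c : ι → ℝ) (k : ι) :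
    Continuous (fun z : ℝ × (ι → ℝ) => slicePoint c k z.1 z.2) := by
  unfold slicePoint; fun_prop

variable [DecidableEq ι]

lemma sum_update_mul (c : ι → ℝ) (k : ι) (t : ℝ) (v : ι → ℝ) :
    ∑ j, update v k t j * c j = c k * t + (∑ j, v j * c j - v k * c k) := by
  rw [← Finset.add_sum_erase Finset.univ _ (Finset.mem_univ k),
    ← Finset.add_sum_erase Finset.univ (fun j => v j * c j) (Finset.mem_univ k)]
  have : ∑ j ∈ Finset.univ.erase k, update v k t j * c j
      = ∑ j ∈ Finset.univ.erase k, v j * c j :=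
    Finset.sum_congr rfl fun j hj => by rw [update_of_ne (Finset.ne_of_mem_erase hj)]
  rw [this, update_self]
  ring

lemma sum_update_slicePoint {c : ι → ℝ} {k : ι} (hc : c k ≠ 0) (y : ℝ) (v : ι → ℝ) :
    ∑ j, update v k (slicePoint c k y v) j * c j = y := by
  rw [sum_update_mul, slicePoint]
  field_simp
  ring

lemma slicePoint_sum_update {c : ι → ℝ} {k : ι} (hc : c k ≠ 0) (t : ℝ) (v : ι → ℝ) :
    slicePoint c k (∑ j, update v k t j * c j) v = t := by
  rw [sum_update_mul, slicePoint]
  field_simp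
  ring

/-- The entry v k cancels against its term in the sum. Hence in `sliceIntegral` the k-th variable of
the product measure is a dummy of total mass one. -/
lemma slicePoint_update {c : ι → ℝ} {k : ι} (hc : c k ≠ 0) (t y : ℝ) (v : ι → ℝ) :
    slicePoint c k y (update v k t) = slicePoint c k y v := by
  rw [slicePoint, sum_update_mul, slicePoint, update_self]
  field_simp
  ring

lemma continuous_update_slicePoint (c : ι → ℝ) (k : ι) :
    Continuous (fun z : ℝ × (ι → ℝ) => update z.2 k (slicePoint c k z.1 z.2)) :=
  continuous_snd.update k (continuous_slicePoint c k)

/-- The density at `y` of the image of `F · ν^{⊗ι}` under `v ↦ ∑ v_j c_j`, computed by solving for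
the `k`-th coordinate; `p` is the density of `ν`. -/
noncomputable def sliceIntegral (ν : Measure ℝ) (p : ℝ → ℝ) (c : ι → ℝ) (k : ι)
    (F : (ι → ℝ) → ℝ≥0∞) (y : ℝ) : ℝ≥0∞ :=
  ENNReal.ofReal |c k|⁻¹ * ∫⁻ v, F (update v k (slicePoint c k y v)) *
    ENNReal.ofReal (p (slicePoint c k y v)) ∂Measure.pi (fun _ : ι => ν)

variable {ν : Measure ℝ} [IsProbabilityMeasure ν] {p : ℝ → ℝ}

/-- Disintegration over the levels of the form: resample the coordinate `k`, in which the form is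
affine with slope `c k`, and substitute its value y for it. -/
lemma lintegral_pi_eq_lintegral_sliceIntegral (hp : Measurable p)
    (hν : ν = volume.withDensity fun x => ENNReal.ofReal (p x)) {c : ι → ℝ} {k : ι}
    (hc : c k ≠ 0) {H : ℝ → (ι → ℝ) → ℝ≥0∞} (hH : Measurable (uncurry H)) :
    ∫⁻ v, H (∑ j, v j * c j) v ∂Measure.pi (fun _ : ι => ν)
      = ∫⁻ y, sliceIntegral ν p c k (H y) y := by
  have hs : Measurable fun v : ι → ℝ => ∑ j, v j * c j := by fun_prop
  have hinner : ∀ v : ι → ℝ, ∫⁻ t, H (∑ j, update v k t j * c j) (update v k t) ∂ν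
      = ENNReal.ofReal |c k|⁻¹ * ∫⁻ y, H y (update v k (slicePoint c k y v)) *
          ENNReal.ofReal (p (slicePoint c k y v)) := by
    intro v
    have hG : Measurable fun y => H y (update v k (slicePoint c k y v)) *
          ENNReal.ofReal (p (slicePoint c k y v)) := by
      have h1 : Measurable fun y : ℝ => slicePoint c k y v :=
        (continuous_slicePoint c k).measurable.comp measurable_prodMk_right
      have h2 : Measurable fun y : ℝ => update v k (slicePoint c k y v) :=
        (continuous_update_slicePoint c k).measurable.comp measurable_prodMk_right
      exact (hH.comp (measurable_id.prodMk h2)).mul (hp.comp h1).ennreal_ofReal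
    have hm : Measurable fun t : ℝ => update v k t := measurable_update v
    rw [lintegral_eq_lintegral_density_mul hp hν (by exact hH.comp ((hs.comp hm).prodMk hm)),
      ← lintegral_comp_mul_add hc (∑ j, v j * c j - v k * c k) hG]
    refine lintegral_congr fun t => ?_
    rw [← sum_update_mul, slicePoint_sum_update hc, mul_comm]
  rw [lintegral_pi_resample k (by exact hH.comp (hs.prodMk measurable_id))]
  simp_rw [hinner]
  have hmeas : Measurable fun z : (ι → ℝ) × ℝ => H z.2 (update z.1 k (slicePoint c k z.2 z.1)) *
      ENNReal.ofReal (p (slicePoint c k z.2 z.1)) := by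
    have h1 := (continuous_slicePoint c k).measurable.comp
      (measurable_swap (α := ι → ℝ) (β := ℝ))
    have h2 := (continuous_update_slicePoint c k).measurable.comp
      (measurable_swap (α := ι → ℝ) (β := ℝ))
    exact (hH.comp (measurable_snd.prodMk h2)).mul (hp.comp h1).ennreal_ofReal
  unfold sliceIntegral
  rw [lintegral_const_mul _ (by exact hmeas.lintegral_prod_right'),
    lintegral_const_mul _ (by exact hmeas.lintegral_prod_left'),
    lintegral_lintegral_swap (by exact hmeas.aemeasurable)]

lemma measurable_sliceIntegral (hp : Measurable p) {c : ι → ℝ} {k : ι}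
    {F : (ι → ℝ) → ℝ≥0∞} (hF : Measurable F) : Measurable (sliceIntegral ν p c k F) := by
  have hmeas : Measurable fun z : ℝ × (ι → ℝ) => F (update z.2 k (slicePoint c k z.1 z.2)) *
      ENNReal.ofReal (p (slicePoint c k z.1 z.2)) :=
    (hF.comp (continuous_update_slicePoint c k).measurable).mul
      (hp.comp (continuous_slicePoint c k).measurable).ennreal_ofReal
  exact hmeas.lintegral_prod_right'.const_mul _

/-- A bound on the image of the measure `F · ν^{⊗ι}` bounds its density at every point. -/
lemma sliceIntegral_le_of_forall_lintegral_le (hp : Continuous p)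
    (hν : ν = volume.withDensity fun x => ENNReal.ofReal (p x)) {c : ι → ℝ} {k : ι}
    (hc : c k ≠ 0) {F : (ι → ℝ) → ℝ≥0∞} (hF : Continuous F) (hFtop : ∀ v, F v ≠ ∞)
    {M : ℝ≥0∞}
    (hM : ∀ B : Set ℝ, MeasurableSet B →
      ∫⁻ v, F v * B.indicator 1 (∑ j, v j * c j) ∂Measure.pi (fun _ : ι => ν) ≤ M * volume B)
    (y : ℝ) : sliceIntegral ν p c k F y ≤ M := by
  have hae : sliceIntegral ν p c k F ≤ᵐ[volume] fun _ => M := by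
    refine ae_le_of_forall_setLIntegral_le_of_sigmaFinite
      (measurable_sliceIntegral hp.measurable hF.measurable) fun B hB _ => ?_
    rw [setLIntegral_const]
    refine le_trans (le_of_eq ?_) (hM B hB)
    rw [lintegral_pi_eq_lintegral_sliceIntegral hp.measurable hν hc
      (H := fun y v => F v * B.indicator 1 y)
      (by
        exact (hF.measurable.comp measurable_snd).mul
          ((measurable_one.indicator hB).comp measurable_fst)),
      ← lintegral_indicator hB]
    refine lintegral_congr fun y => ?_
    by_cases hy : y ∈ B <;> simp [hy, sliceIntegral]
  -- The almost everywhere bound holds on a dense set. Approach y from it: the integrand is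
  -- continuous in the level, so Fatou carries the bound to y itself.
  obtain ⟨u, hu, hlim⟩ := mem_closure_iff_seq_limit.1 (Measure.dense_of_ae hae y)
  have hk : ENNReal.ofReal |c k|⁻¹ ≠ 0 := by simpa using hc
  have hcont : ∀ v : ι → ℝ, Continuous fun y : ℝ => F (update v k (slicePoint c k y v)) *
      ENNReal.ofReal (p (slicePoint c k y v)) := by
    intro v
    have h1 : Continuous fun y : ℝ => slicePoint c k y v := by
      unfold slicePoint; fun_prop
    have h2 : Continuous fun y : ℝ => update v k (slicePoint c k y v) :=
      continuous_const.update k h1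
    refine continuous_iff_continuousAt.2 fun z => ?_
    exact ENNReal.Tendsto.mul (hF.comp h2).continuousAt (Or.inr ENNReal.ofReal_ne_top)
      (ENNReal.continuous_ofReal.comp (hp.comp h1)).continuousAt (Or.inr (hFtop _))
  have hfatou := lintegral_liminf_le (u := atTop) (μ := Measure.pi fun _ : ι => ν)
    (f := fun m v => F (update v k (slicePoint c k (u m) v)) *
      ENNReal.ofReal (p (slicePoint c k (u m) v))) fun m => by
        have h1 : Measurable fun v : ι → ℝ => slicePoint c k (u m) v :=
          (continuous_slicePoint c k).measurable.comp measurable_prodMk_left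
        have h2 : Measurable fun v : ι → ℝ => update v k (slicePoint c k (u m) v) :=
          (continuous_update_slicePoint c k).measurable.comp measurable_prodMk_left
        exact (hF.measurable.comp h2).mul (hp.measurable.comp h1).ennreal_ofReal
  have hl : ∀ v : ι → ℝ, liminf (fun m => F (update v k (slicePoint c k (u m) v)) *
      ENNReal.ofReal (p (slicePoint c k (u m) v))) atTop
      = F (update v k (slicePoint c k y v)) * ENNReal.ofReal (p (slicePoint c k y v)) :=
    fun v => (((hcont v).tendsto y).comp hlim).liminf_eq
  simp_rw [hl] at hfatou
  rw [sliceIntegral, mul_comm, ← ENNReal.le_div_iff_mul_le (Or.inl hk)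
    (Or.inl ENNReal.ofReal_ne_top)]
  refine hfatou.trans (liminf_le_of_le (by isBoundedDefault) fun b hb => ?_)
  obtain ⟨m, hm⟩ := hb.exists
  refine hm.trans ?_
  rw [ENNReal.le_div_iff_mul_le (Or.inl hk) (Or.inl ENNReal.ofReal_ne_top), mul_comm]
  exact hu m

end Slicing

/-! ### Moments and anti-concentration of linear forms -/

section LinearForms

variable {ι : Type*} [Fintype ι]
variable {ν : Measure ℝ} [IsProbabilityMeasure ν]

lemma one_add_sum_le_prod_one_add_of_nonneg {ι : Type*} {x : ι → ℝ} (hx : ∀ i, 0 ≤ x i) (s : Finset ι) :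
    1 + ∑ i ∈ s, x i ≤ ∏ i ∈ s, (1 + x i) := by
  classical
  induction s using Finset.induction_on with
  | empty => simp
  | insert k s hk ih =>
    rw [Finset.sum_insert hk, Finset.prod_insert hk]
    have h1 : 0 ≤ ∑ i ∈ s, x i := Finset.sum_nonneg fun i _ => hx i
    nlinarith [hx k, mul_nonneg (hx k) h1]

lemma iIndepFun_pi_mul (c : ι → ℝ) :
    iIndepFun (fun (j : ι) (v : ι → ℝ) => v j * c j) (Measure.pi fun _ : ι => ν) :=
  iIndepFun_pi (X := fun j (t : ℝ) => t * c j) fun j => by fun_prop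

lemma charFun_map_sum_mul (c : ι → ℝ) (s : ℝ) :
    charFun ((Measure.pi fun _ : ι => ν).map fun v => ∑ j, v j * c j) s
      = ∏ j, charFun ν (c j * s) := by
  rw [(iIndepFun_pi_mul c).charFun_map_fun_sum_eq_prod
    fun j => ((measurable_pi_apply j).mul_const (c j)).aemeasurable, Finset.prod_apply]
  refine Finset.prod_congr rfl fun j _ => ?_
  have h : (fun v : ι → ℝ => v j * c j) = (fun t : ℝ => c j * t) ∘ fun v => v j := by
    ext v; simp [mul_comm]
  rw [h, ← Measure.map_map (by fun_prop) (by fun_prop),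
    (measurePreserving_eval (fun _ : ι => ν) j).map_eq, charFun_map_mul]

/-- The characteristic function factors, and expanding ∏ (1 + b c_j² s²) while keeping only the
terms of order at most one reproduces the same shape of bound. -/
lemma norm_charFun_map_sum_mul_le {b : ℝ} (hb : 0 < b)
    (h : ∀ s, ‖charFun ν s‖ ≤ 1 / (1 + b * s ^ 2)) (c : ι → ℝ) (s : ℝ) :
    ‖charFun ((Measure.pi fun _ : ι => ν).map fun v => ∑ j, v j * c j) s‖
      ≤ 1 / (1 + (b * ∑ j, c j ^ 2) * s ^ 2) := by
  rw [charFun_map_sum_mul, norm_prod]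
  calc _ ≤ ∏ j, 1 / (1 + b * (c j * s) ^ 2) :=
        Finset.prod_le_prod (fun j _ => norm_nonneg _) fun j _ => h _
    _ = 1 / ∏ j, (1 + b * (c j * s) ^ 2) := by simp
    _ ≤ _ := by
        have := one_add_sum_le_prod_one_add_of_nonneg (x := fun j => b * (c j * s) ^ 2)
          (fun j => by positivity) Finset.univ
        refine one_div_le_one_div_of_le ?_ (le_trans (le_of_eq ?_) this)
        · positivity
        · congr 1
          rw [Finset.mul_sum, Finset.sum_mul]
          exact Finset.sum_congr rfl fun j _ => by ring

/-- Anti-concentration for linear forms of independent variables. -/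
lemma measure_sum_mul_mem_le {b : ℝ} (hb : 0 < b)
    (h : ∀ s, ‖charFun ν s‖ ≤ 1 / (1 + b * s ^ 2)) {c : ι → ℝ} (hc : 0 < ∑ j, c j ^ 2)
    {B : Set ℝ} (hB : MeasurableSet B) :
    (Measure.pi fun _ : ι => ν) {v | ∑ j, v j * c j ∈ B}
      ≤ ENNReal.ofReal (1 / (2 * √(b * ∑ j, c j ^ 2))) * volume B := by
  have hm : Measurable fun v : ι → ℝ => ∑ j, v j * c j := by fun_prop
  have : IsProbabilityMeasure ((Measure.pi fun _ : ι => ν).map fun v => ∑ j, v j * c j) :=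
    Measure.isProbabilityMeasure_map hm.aemeasurable
  obtain ⟨r, -, -, hr, hmap⟩ := exists_continuous_density_of_norm_charFun_le _
    (mul_pos hb hc) (norm_charFun_map_sum_mul_le hb h c)
  have h1 : (Measure.pi fun _ : ι => ν) {v | ∑ j, v j * c j ∈ B}
      = ((Measure.pi fun _ : ι => ν).map fun v => ∑ j, v j * c j) B :=
    (Measure.map_apply hm hB).symm
  rw [h1, hmap, withDensity_apply _ hB, ← setLIntegral_const]
  exact lintegral_mono fun x => ENNReal.ofReal_le_ofReal (hr x)

lemma lintegral_abs_sum_mul_le (hmem : MemLp id 2 ν) (h0 : ∫ x, x ∂ν = 0)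
    (h2 : ∫ x, x ^ 2 ∂ν = 1) (c : ι → ℝ) :
    ∫⁻ v, ENNReal.ofReal |∑ j, v j * c j| ∂(Measure.pi fun _ : ι => ν)
      ≤ ENNReal.ofReal √(∑ j, c j ^ 2) := by
  set π := Measure.pi fun _ : ι => ν
  have hev : ∀ j, MemLp (fun v : ι → ℝ => v j) 2 π := fun j =>
    hmem.comp_measurePreserving (measurePreserving_eval (fun _ : ι => ν) j)
  have hmc : ∀ j, MemLp (fun v : ι → ℝ => v j * c j) 2 π := fun j => (hev j).mul_const (c j)
  have hY : MemLp (fun v : ι → ℝ => ∑ j, v j * c j) 2 π :=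
    memLp_finsetSum _ fun j _ => hmc j
  have hi : ∀ j, ∫ v, v j ∂π = 0 := fun j => by
    have := integral_comp_eval (μ := fun _ : ι => ν) (i := j) (f := fun x : ℝ => x)
      measurable_id.aestronglyMeasurable
    rw [this, h0]
  have hY0 : ∫ v, ∑ j, v j * c j ∂π = 0 := by
    rw [integral_finsetSum _ fun j _ => (hmc j).integrable (by norm_num)]
    refine Finset.sum_eq_zero fun j _ => ?_
    rw [integral_mul_const, hi, zero_mul]
  have hv1 : Var[fun v : ι → ℝ => ∑ j, v j * c j; π] = ∑ j, c j ^ 2 := by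
    have hs := IndepFun.variance_sum (μ := π) (X := fun (j : ι) (v : ι → ℝ) => v j * c j)
      (s := Finset.univ) (fun j _ => hmc j)
      (fun i _ j _ hij => (iIndepFun_pi_mul (ν := ν) c).indepFun hij)
    have hf : (∑ j, fun v : ι → ℝ => v j * c j) = fun v => ∑ j, v j * c j := by
      ext v; simp
    rw [hf] at hs
    rw [hs]
    refine Finset.sum_congr rfl fun j _ => ?_
    rw [variance_mul_const, variance_of_integral_eq_zero
      (measurable_pi_apply j).aemeasurable (hi j)]
    have := integral_comp_eval (μ := fun _ : ι => ν) (i := j) (f := fun x : ℝ => x ^ 2)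
      (by fun_prop)
    rw [this, h2, one_mul]
  -- Nonnegativity of the variance of |Y| is (E|Y|)² ≤ E Y², and E Y² = ∑ c_j² by independence and
  -- centering.
  have hv2 := variance_nonneg (fun v : ι → ℝ => |∑ j, v j * c j|) π
  rw [variance_eq_sub (X := fun v : ι → ℝ => |∑ j, v j * c j|) hY.abs] at hv2
  rw [variance_of_integral_eq_zero hY.aemeasurable hY0] at hv1
  have hsq : ((fun v : ι → ℝ => |∑ j, v j * c j|) ^ 2) = fun v => (∑ j, v j * c j) ^ 2 := by
    ext v; simp [sq_abs]
  rw [hsq, hv1] at hv2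
  rw [← ofReal_integral_eq_lintegral_ofReal (f := fun v : ι → ℝ => |∑ j, v j * c j|)
    (hY.abs.integrable (by norm_num))
    (Eventually.of_forall fun v => abs_nonneg _)]
  exact ENNReal.ofReal_le_ofReal (Real.le_sqrt_of_sq_le (by linarith))

variable [DecidableEq ι]

/-- If `c` is supported on `A`, then `∑ v_j c_j` is independent of the part of `∑ v_j g_j` outside
`A`, which has bounded density. -/
lemma lintegral_abs_sum_mul_indicator_le {b : ℝ} (hb : 0 < b)
    (h : ∀ s, ‖charFun ν s‖ ≤ 1 / (1 + b * s ^ 2)) (hmem : MemLp id 2 ν)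
    (h0 : ∫ x, x ∂ν = 0) (h2 : ∫ x, x ^ 2 ∂ν = 1) (A : Finset ι) {c g : ι → ℝ}
    (hc : ∀ j ∉ A, c j = 0) (hg : 0 < ∑ j ∈ Aᶜ, g j ^ 2) {B : Set ℝ} (hB : MeasurableSet B) :
    ∫⁻ v, ENNReal.ofReal |∑ j, v j * c j| * B.indicator 1 (∑ j, v j * g j)
        ∂(Measure.pi fun _ : ι => ν)
      ≤ ENNReal.ofReal (√(∑ j, c j ^ 2) * (1 / (2 * √(b * ∑ j ∈ Aᶜ, g j ^ 2)))) * volume B := by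
  set π := Measure.pi fun _ : ι => ν
  set U : (ι → ℝ) → ℝ × ℝ := fun v => (∑ j ∈ A, v j * c j, ∑ j ∈ A, v j * g j) with hU
  set V : (ι → ℝ) → ℝ := fun v => ∑ j ∈ Aᶜ, v j * g j with hV
  have hUm : Measurable U := by fun_prop
  have hVm : Measurable V := by fun_prop
  have hind : IndepFun U V π := by
    have h1 := (iIndepFun_pi (μ := fun _ : ι => ν) (X := fun _ (t : ℝ) => t)
      fun j => by fun_prop).indepFun_finset A Aᶜ disjoint_compl_right
      (fun j => measurable_pi_apply j)
    have h2 := h1.comp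
      (φ := fun w : A → ℝ => ((∑ j : A, w j * c j, ∑ j : A, w j * g j) : ℝ × ℝ))
      (ψ := fun w : (Aᶜ : Finset ι) → ℝ => ∑ j : (Aᶜ : Finset ι), w j * g j)
      (by fun_prop) (by fun_prop)
    convert h2 using 1
    · ext v
      · simp only [hU, comp_apply]
        exact (Finset.sum_coe_sort A fun j => v j * c j).symm
      · simp only [hU, comp_apply]
        exact (Finset.sum_coe_sort A fun j => v j * g j).symm
    · ext v
      simp only [hV, comp_apply]
      exact (Finset.sum_coe_sort Aᶜ fun j => v j * g j).symm
  have hcA : ∀ v : ι → ℝ, ∑ j, v j * c j = ∑ j ∈ A, v j * c j := fun v =>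
    (Finset.sum_subset (Finset.subset_univ A) fun j _ hj => by rw [hc j hj, mul_zero]).symm
  have hsplit : ∀ v, ENNReal.ofReal |∑ j, v j * c j| * B.indicator 1 (∑ j, v j * g j)
      = (fun z : (ℝ × ℝ) × ℝ => ENNReal.ofReal |z.1.1| * B.indicator 1 (z.1.2 + z.2))
        (U v, V v) := by
    intro v
    simp only [hU, hV, Finset.sum_add_sum_compl]
    rw [hcA]
  have hΨ : Measurable fun z : (ℝ × ℝ) × ℝ =>
      ENNReal.ofReal |z.1.1| * B.indicator (1 : ℝ → ℝ≥0∞) (z.1.2 + z.2) := by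
    refine Measurable.mul (by fun_prop) ((measurable_one.indicator hB).comp (by fun_prop))
  have hgc : ∑ j, (if j ∈ A then 0 else g j) ^ 2 = ∑ j ∈ Aᶜ, g j ^ 2 := by
    rw [← Finset.sum_add_sum_compl A]
    have e1 : ∑ j ∈ A, (if j ∈ A then 0 else g j) ^ 2 = 0 :=
      Finset.sum_eq_zero fun j hj => by simp [hj]
    have e2 : ∑ j ∈ Aᶜ, (if j ∈ A then 0 else g j) ^ 2 = ∑ j ∈ Aᶜ, g j ^ 2 :=
      Finset.sum_congr rfl fun j hj => by simp [Finset.mem_compl.1 hj]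
    rw [e1, e2, zero_add]
  have hVsum : ∀ v, V v = ∑ j, v j * (if j ∈ A then 0 else g j) := by
    intro v
    rw [← Finset.sum_add_sum_compl A]
    have e1 : ∑ j ∈ A, v j * (if j ∈ A then 0 else g j) = 0 :=
      Finset.sum_eq_zero fun j hj => by simp [hj]
    have e2 : ∑ j ∈ Aᶜ, v j * (if j ∈ A then 0 else g j) = ∑ j ∈ Aᶜ, v j * g j :=
      Finset.sum_congr rfl fun j hj => by simp [Finset.mem_compl.1 hj]
    rw [e1, e2, zero_add]
  -- With the variables in `A` frozen, their contribution r only translates `B`, so the density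
  -- bound for `V` is uniform in r.
  have hVB : ∀ r : ℝ, ∫⁻ w, B.indicator 1 (r + w) ∂(π.map V)
      ≤ ENNReal.ofReal (1 / (2 * √(b * ∑ j ∈ Aᶜ, g j ^ 2))) * volume B := by
    intro r
    have hBr : MeasurableSet ((fun w => r + w) ⁻¹' B) := hB.preimage (by fun_prop)
    have e : (fun w => B.indicator (1 : ℝ → ℝ≥0∞) (r + w))
        = ((fun w => r + w) ⁻¹' B).indicator 1 := by
      ext w; rfl
    rw [e, lintegral_indicator_one hBr, Measure.map_apply hVm hBr]
    have := measure_sum_mul_mem_le hb h (c := fun j => if j ∈ A then 0 else g j)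
      (by rw [hgc]; exact hg) hBr
    rw [hgc, measure_preimage_add] at this
    convert this using 2
    ext v
    simp [hVsum]
  calc _ = ∫⁻ z, ENNReal.ofReal |z.1.1| * B.indicator 1 (z.1.2 + z.2)
          ∂(π.map fun v => (U v, V v)) := by
        rw [lintegral_map hΨ (hUm.prodMk hVm)]
        exact lintegral_congr hsplit
    _ = ∫⁻ u, ∫⁻ w, ENNReal.ofReal |u.1| * B.indicator 1 (u.2 + w) ∂(π.map V) ∂(π.map U) := by
        rw [(indepFun_iff_map_prod_eq_prod_map_map hUm.aemeasurable hVm.aemeasurable).1 hind,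
          lintegral_prod _ hΨ.aemeasurable]
    _ ≤ ∫⁻ u, ENNReal.ofReal |u.1| *
          (ENNReal.ofReal (1 / (2 * √(b * ∑ j ∈ Aᶜ, g j ^ 2))) * volume B) ∂(π.map U) := by
        refine lintegral_mono fun u => ?_
        rw [lintegral_const_mul _
          (by exact (measurable_one.indicator hB).comp (measurable_const_add u.2))]
        gcongr
        exact hVB u.2
    _ = (∫⁻ v, ENNReal.ofReal |∑ j, v j * c j| ∂π) *
          (ENNReal.ofReal (1 / (2 * √(b * ∑ j ∈ Aᶜ, g j ^ 2))) * volume B) := by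
        rw [lintegral_mul_const _ (by fun_prop), lintegral_map (by fun_prop) hUm]
        congr 1
        refine lintegral_congr fun v => ?_
        simp only [hU, hcA]
    _ ≤ _ := by
        rw [ENNReal.ofReal_mul (Real.sqrt_nonneg _), mul_assoc]
        gcongr
        exact lintegral_abs_sum_mul_le hmem h0 h2 c

end LinearForms

/-- Real numbers with positive sum, none of which exceeds a third of their sum can be split into two parts of
comparable size. -/
lemma exists_finset_balanced_sum {ι : Type*} [Fintype ι] {x : ι → ℝ}
    (hpos : 0 < ∑ i, x i) (hle : ∀ i, x i ≤ (∑ i, x i) / 3) :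
    ∃ A : Finset ι, (∑ i, x i) / 3 ≤ ∑ i ∈ A, x i ∧ ∑ i ∈ A, x i ≤ 2 * (∑ i, x i) / 3 := by
  classical
  by_contra! hno
  -- Greedy argument: if no sum lies in the middle third, adding one element to a sum below a third
  -- keeps it below two thirds, hence below a third. The full sum would then be too small.
  have key : ∀ s : Finset ι, ∑ i ∈ s, x i < (∑ i, x i) / 3 := by
    intro s
    induction s using Finset.induction_on with
    | empty => simpa using hpos
    | insert k s hk ih =>
      by_contra! h
      have h1 := hno _ h
      rw [Finset.sum_insert hk] at h1
      linarith [hle k]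
  linarith [key Finset.univ]

/-! ### The bound for the Kac–Rice integral -/

section SliceBound

variable {ι : Type*} [Fintype ι]

lemma sum_sub_mul_sq (g g' : ι → ℝ) (τ : ℝ) :
    ∑ j, (g' j - τ * g j) ^ 2
      = ∑ j, g' j ^ 2 - 2 * τ * ∑ j, g j * g' j + τ ^ 2 * ∑ j, g j ^ 2 := by
  rw [Finset.mul_sum, Finset.mul_sum, ← Finset.sum_sub_distrib, ← Finset.sum_add_distrib]
  exact Finset.sum_congr rfl fun j _ => by ring

/-- Here D is the squared norm of the derivative form and G the part of K outside its support. The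
hypothesis is the squared conclusion, with 12 = (2√3)². It is used with t = 1 for a heavy coordinate
and t = 1/2 for each of two halves. -/
lemma sqrt_mul_one_div_le {b D G K Δ t : ℝ} (hb : 0 < b) (hG : 0 < G) (hK : 0 < K)
    (hΔ : 0 ≤ Δ) (ht : 0 ≤ t) (h : D * K ^ 2 ≤ 12 * t ^ 2 * Δ * G) :
    √D * (1 / (2 * √(b * G))) ≤ t * (√3 / √b * (√Δ / K)) := by
  have h1 : √D * K ≤ 2 * √3 * t * √Δ * √G := by
    rcases le_or_gt D 0 with hD | hD
    · rw [Real.sqrt_eq_zero_of_nonpos hD, zero_mul]; positivity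
    · refine le_of_sq_le_sq ?_ (by positivity)
      have : (2 * √3 * t * √Δ * √G) ^ 2 = 4 * √3 ^ 2 * t ^ 2 * √Δ ^ 2 * √G ^ 2 := by ring
      rw [this, mul_pow, Real.sq_sqrt hD.le, Real.sq_sqrt hΔ, Real.sq_sqrt hG.le,
        Real.sq_sqrt (by norm_num)]
      linarith
  rw [Real.sqrt_mul hb.le]
  have hb' := Real.sqrt_pos.2 hb
  have hG' := Real.sqrt_pos.2 hG
  have e1 : √D * (1 / (2 * (√b * √G))) = √D / (2 * √b * √G) := by ring
  have e2 : t * (√3 / √b * (√Δ / K)) = t * √3 * √Δ / (√b * K) := by field_simp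
  rw [e1, e2, div_le_div_iff₀ (by positivity) (by positivity)]
  nlinarith [mul_le_mul_of_nonneg_left h1 hb'.le]

variable [DecidableEq ι] {ν : Measure ℝ} {p : ℝ → ℝ}

/-- The derivative form may be changed by a multiple of `g` on the slice `∑ v_j g_j = 0`. -/
lemma sliceIntegral_abs_sub_mul {g : ι → ℝ} {k : ι} (hk : g k ≠ 0) (g' : ι → ℝ) (τ : ℝ) :
    sliceIntegral ν p g k (fun v => ENNReal.ofReal |∑ j, v j * g' j|) 0
      = sliceIntegral ν p g k (fun v => ENNReal.ofReal |∑ j, v j * (g' j - τ * g j)|) 0 := by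
  unfold sliceIntegral
  congr 1
  refine lintegral_congr fun v => ?_
  have h : ∀ u : ι → ℝ, ∑ j, u j * (g' j - τ * g j)
      = ∑ j, u j * g' j - τ * ∑ j, u j * g j := by
    intro u
    rw [Finset.mul_sum, ← Finset.sum_sub_distrib]
    exact Finset.sum_congr rfl fun j _ => by ring
  simp only [h, sum_update_slicePoint hk, mul_zero, sub_zero]

variable [IsProbabilityMeasure ν]

lemma sliceIntegral_abs_le_of_support (hp : Continuous p)
    (hν : ν = volume.withDensity fun x => ENNReal.ofReal (p x)) {b : ℝ} (hb : 0 < b)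
    (h : ∀ s, ‖charFun ν s‖ ≤ 1 / (1 + b * s ^ 2)) (hmem : MemLp id 2 ν)
    (h0 : ∫ x, x ∂ν = 0) (h2 : ∫ x, x ^ 2 ∂ν = 1) {c g : ι → ℝ} {k : ι} (hk : g k ≠ 0)
    (A : Finset ι) (hc : ∀ j ∉ A, c j = 0) (hg : 0 < ∑ j ∈ Aᶜ, g j ^ 2) :
    sliceIntegral ν p g k (fun v => ENNReal.ofReal |∑ j, v j * c j|) 0
      ≤ ENNReal.ofReal (√(∑ j, c j ^ 2) * (1 / (2 * √(b * ∑ j ∈ Aᶜ, g j ^ 2)))) :=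
  sliceIntegral_le_of_forall_lintegral_le hp hν hk
    (ENNReal.continuous_ofReal.comp (by fun_prop)) (fun _ => ENNReal.ofReal_ne_top)
    (fun _ hB => lintegral_abs_sum_mul_indicator_le hb h hmem h0 h2 A hc hg hB) 0

/-- Bound for `∫ |y| D(0, y) dy`, with `D` the joint density of `∑ v_j g_j` and `∑ v_j g'_j`. -/
theorem sliceIntegral_abs_le (hp : Continuous p)
    (hν : ν = volume.withDensity fun x => ENNReal.ofReal (p x)) {b : ℝ} (hb : 0 < b)
    (h : ∀ s, ‖charFun ν s‖ ≤ 1 / (1 + b * s ^ 2)) (hmem : MemLp id 2 ν)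
    (h0 : ∫ x, x ∂ν = 0) (h2 : ∫ x, x ^ 2 ∂ν = 1) {g : ι → ℝ} {k : ι} (hk : g k ≠ 0)
    (g' : ι → ℝ) :
    sliceIntegral ν p g k (fun v => ENNReal.ofReal |∑ j, v j * g' j|) 0
      ≤ ENNReal.ofReal (√3 / √b *
        (√((∑ j, g' j ^ 2) * (∑ j, g j ^ 2) - (∑ j, g j * g' j) ^ 2) / ∑ j, g j ^ 2)) := by
  set K := ∑ j, g j ^ 2 with hKdef
  set K₁ := ∑ j, g j * g' j with hK₁
  set K₂ := ∑ j, g' j ^ 2 with hK₂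
  have hKpos : 0 < K := lt_of_lt_of_le (by positivity)
    (Finset.single_le_sum (f := fun j => g j ^ 2) (fun j _ => sq_nonneg _) (Finset.mem_univ k))
  -- The component of g' orthogonal to g; its squared norm is Δ / K.
  set c : ι → ℝ := fun j => g' j - K₁ / K * g j with hcdef
  have hc2 : ∑ j, c j ^ 2 = (K₂ * K - K₁ ^ 2) / K := by
    rw [hcdef, sum_sub_mul_sq, ← hKdef, ← hK₁, ← hK₂]
    field_simp
    ring
  have hΔ : 0 ≤ K₂ * K - K₁ ^ 2 := by
    have h1 : 0 ≤ ∑ j, c j ^ 2 := Finset.sum_nonneg fun j _ => sq_nonneg _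
    rw [hc2, le_div_iff₀ hKpos, zero_mul] at h1
    exact h1
  set Δ := K₂ * K - K₁ ^ 2 with hΔdef
  by_cases hbig : ∃ m, K / 3 ≤ g m ^ 2
  · obtain ⟨m, hm⟩ := hbig
    have hm0 : 0 < g m ^ 2 := lt_of_lt_of_le (by positivity) hm
    have hgm : g m ≠ 0 := fun h => by simp [h] at hm0
    -- This multiple of g makes the m-th coefficient vanish, leaving v_m g_m as the independent
    -- part.
    rw [sliceIntegral_abs_sub_mul hk g' (g' m / g m)]
    have hcompl : ∑ j ∈ ({m}ᶜ : Finset ι)ᶜ, g j ^ 2 = g m ^ 2 := by simp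
    refine (sliceIntegral_abs_le_of_support hp hν hb h hmem h0 h2 hk ({m}ᶜ) ?_ ?_).trans ?_
    · intro j hj
      have : j = m := by simpa using hj
      subst this
      field_simp
      ring
    · rwa [hcompl]
    · refine ENNReal.ofReal_le_ofReal ?_
      rw [hcompl, ← one_mul (√3 / √b * (√Δ / K))]
      refine sqrt_mul_one_div_le hb hm0 hKpos hΔ zero_le_one ?_
      rw [sum_sub_mul_sq, ← hKdef, ← hK₁, ← hK₂]
      have hcm : c m ^ 2 ≤ Δ / K := by
        rw [← hc2]
        exact Finset.single_le_sum (f := fun j => c j ^ 2) (fun j _ => sq_nonneg _)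
          (Finset.mem_univ m)
      rw [le_div_iff₀ hKpos] at hcm
      set τ := g' m / g m with hτ
      have hg'm : g' m = τ * g m := by rw [hτ]; field_simp
      have hcm' : g m ^ 2 * (K * τ - K₁) ^ 2 ≤ K * Δ := by
        have e : c m * K = g m * (K * τ - K₁) := by
          simp only [hcdef]; rw [hg'm]; field_simp
        have e2 : c m ^ 2 * K * K = g m ^ 2 * (K * τ - K₁) ^ 2 := by
          rw [← mul_pow, ← e]; ring
        rw [← e2]
        nlinarith
      have h4 : K * (K₂ - 2 * τ * K₁ + τ ^ 2 * K) = Δ + (K * τ - K₁) ^ 2 := by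
        rw [hΔdef]; ring
      -- Replacing the orthogonal projection by the new τ costs at most 3Δ, because g_m² ≥ K/3.
      -- Hence K · D ≤ 4Δ, and K ≤ 3 g_m² turns 4 into 12.
      have h5 : (K * τ - K₁) ^ 2 ≤ 3 * Δ := by
        have : K / 3 * (K * τ - K₁) ^ 2 ≤ g m ^ 2 * (K * τ - K₁) ^ 2 :=
          mul_le_mul_of_nonneg_right hm (sq_nonneg _)
        have h6 : K * (K * τ - K₁) ^ 2 ≤ K * (3 * Δ) := by linarith
        exact le_of_mul_le_mul_left h6 hKpos
      calc (K₂ - 2 * τ * K₁ + τ ^ 2 * K) * K ^ 2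
          = K * (Δ + (K * τ - K₁) ^ 2) := by rw [← h4]; ring
        _ ≤ K * (4 * Δ) := mul_le_mul_of_nonneg_left (by linarith) hKpos.le
        _ ≤ 12 * 1 ^ 2 * Δ * g m ^ 2 := by nlinarith
  · push Not at hbig
    obtain ⟨A, hA1, hA2⟩ := exists_finset_balanced_sum (x := fun j => g j ^ 2)
      hKpos fun j => (hbig j).le
    rw [← hKdef] at hA1 hA2
    have hsum : ∑ j ∈ A, g j ^ 2 + ∑ j ∈ Aᶜ, g j ^ 2 = K := Finset.sum_add_sum_compl A _
    -- No coordinate is heavy: use the orthogonal component and cut it along A and its complement.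
    -- Each piece has squared norm at most Δ/K and faces mass at least K/3, which gives half of the
    -- bound.
    rw [sliceIntegral_abs_sub_mul hk g' (K₁ / K)]
    have hpart : ∀ A : Finset ι, K / 3 ≤ ∑ j ∈ Aᶜ, g j ^ 2 →
        sliceIntegral ν p g k
          (fun v => ENNReal.ofReal |∑ j, v j * (if j ∈ A then c j else 0)|) 0
        ≤ ENNReal.ofReal (1 / 2 * (√3 / √b * (√Δ / K))) := by
      intro A hA
      have hApos : 0 < ∑ j ∈ Aᶜ, g j ^ 2 := lt_of_lt_of_le (by positivity) hA
      refine (sliceIntegral_abs_le_of_support hp hν hb h hmem h0 h2 hk A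
        (fun j hj => if_neg hj) hApos).trans (ENNReal.ofReal_le_ofReal ?_)
      refine sqrt_mul_one_div_le hb hApos hKpos hΔ (by norm_num) ?_
      have h1 : ∑ j, (if j ∈ A then c j else 0) ^ 2 ≤ Δ / K := by
        rw [← hc2]
        refine Finset.sum_le_sum fun j _ => ?_
        split_ifs
        · exact le_rfl
        · simpa using sq_nonneg (c j)
      calc _ ≤ Δ / K * K ^ 2 := mul_le_mul_of_nonneg_right h1 (sq_nonneg _)
        _ = Δ * K := by field_simp
        _ ≤ _ := by nlinarith
    calc _ ≤ sliceIntegral ν p g k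
            (fun v => ENNReal.ofReal |∑ j, v j * (if j ∈ A then c j else 0)|) 0
          + sliceIntegral ν p g k
            (fun v => ENNReal.ofReal |∑ j, v j * (if j ∈ Aᶜ then c j else 0)|) 0 := by
          have hs : Continuous (slicePoint g k 0) :=
            (continuous_slicePoint g k).comp (by fun_prop : Continuous fun v => ((0 : ℝ), v))
          have hu : Continuous fun v : ι → ℝ => update v k (slicePoint g k 0 v) :=
            continuous_id.update k hs
          unfold sliceIntegral
          rw [← mul_add, ← lintegral_add_left]
          · gcongr with v
            rw [← add_mul, ← ENNReal.ofReal_add (abs_nonneg _) (abs_nonneg _)]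
            gcongr
            refine ENNReal.ofReal_le_ofReal (le_trans (le_of_eq ?_) (abs_add_le _ _))
            rw [← Finset.sum_add_distrib]
            congr 1
            refine Finset.sum_congr rfl fun j _ => ?_
            by_cases hj : j ∈ A <;> simp [hj, hcdef]
          · refine Measurable.mul ?_ (hp.comp hs).measurable.ennreal_ofReal
            exact (Continuous.measurable (f := fun u : ι → ℝ =>
              ENNReal.ofReal |∑ j, u j * (if j ∈ A then c j else 0)|)
              (ENNReal.continuous_ofReal.comp (by fun_prop))).comp hu.measurable
      _ ≤ ENNReal.ofReal (1 / 2 * (√3 / √b * (√Δ / K)))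
          + ENNReal.ofReal (1 / 2 * (√3 / √b * (√Δ / K))) := by
          refine add_le_add (hpart A (by linarith)) (hpart Aᶜ ?_)
          rwa [compl_compl]
      _ = _ := by
          rw [← ENNReal.ofReal_add (by positivity) (by positivity)]
          congr 1; ring

end SliceBound

/-! ### The Kac–Rice formula through the area formula -/

section KacRice

variable {ι : Type*} [Fintype ι] [DecidableEq ι]

/-- Reads the `k`-th coordinate `w_k` as a point of the real line, and replaces it by the value
for which `∑ w_j g_j` vanishes at that point. -/
noncomputable def zeroMap (g : ι → ℝ → ℝ) (k : ι) (w : ι → ℝ) : ι → ℝ :=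
  update w k (slicePoint (fun j => g j (w k)) k 0 w)

lemma zeroMap_update {g : ι → ℝ → ℝ} {k : ι} {x : ℝ} (hx : g k x ≠ 0) (v : ι → ℝ) :
    zeroMap g k (update v k x) = update v k (slicePoint (fun j => g j x) k 0 v) := by
  unfold zeroMap
  rw [update_self, update_idem, slicePoint_update (c := fun j => g j x) hx]

/-- Implicit differentiation of ∑ v_j g_j(t) = 0 in the solved coordinate. -/
lemma hasDerivAt_slicePoint {g g' : ι → ℝ → ℝ} (hd : ∀ j x, HasDerivAt (g j) (g' j x) x)
    {k : ι} {x : ℝ} (hx : g k x ≠ 0) (v : ι → ℝ) :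
    HasDerivAt (fun t => slicePoint (fun j => g j t) k 0 v)
      (-(∑ j, update v k (slicePoint (fun j => g j x) k 0 v) j * g' j x) / g k x) x := by
  unfold slicePoint
  have h1 : HasDerivAt (fun t => ∑ j, v j * g j t) (∑ j, v j * g' j x) x :=
    HasDerivAt.fun_sum fun j _ => (hd j x).const_mul (v j)
  have h2 := ((h1.const_sub 0).div (hd k x) hx).const_add (v k)
  refine h2.congr_deriv ?_
  rw [sum_update_mul (fun j => g' j x)]
  field_simp
  ring

/-- Only the coordinate `k` is changed, so the derivative is the identity plus a rank-one map with
range in the line of e_k. Its determinant is the partial derivative of the new k-th entry in w_k. -/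
lemma exists_hasStrictFDerivAt_zeroMap {g g' : ι → ℝ → ℝ} (hg : ∀ j, ContDiff ℝ 1 (g j))
    (hd : ∀ j x, HasDerivAt (g j) (g' j x) x) {k : ι} {w : ι → ℝ} (hw : g k (w k) ≠ 0) :
    ∃ T' : (ι → ℝ) →L[ℝ] (ι → ℝ), HasStrictFDerivAt (zeroMap g k) T' w ∧
      T'.det = -(∑ j, zeroMap g k w j * g' j (w k)) / g k (w k) := by
  set h : (ι → ℝ) → ℝ := fun w => slicePoint (fun j => g j (w k)) k 0 w with hh
  have hcd : ContDiffAt ℝ 1 h w := by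
    simp only [hh]
    unfold slicePoint
    have hgk : ∀ j, ContDiff ℝ 1 fun w : ι → ℝ => g j (w k) := fun j =>
      (hg j).comp (contDiff_apply ℝ ℝ k)
    have hn : ContDiff ℝ 1 fun w : ι → ℝ => 0 - ∑ j, w j * g j (w k) :=
      contDiff_const.sub (ContDiff.sum fun j _ => (contDiff_apply ℝ ℝ j).mul (hgk j))
    exact (contDiff_apply ℝ ℝ k).contDiffAt.add (hn.contDiffAt.div (hgk k).contDiffAt hw)
  have hstrict : HasStrictFDerivAt h (fderiv ℝ h w) w := hcd.hasStrictFDerivAt (by norm_num)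
  set D := fderiv ℝ h w with hD
  have hline : D (Pi.single k 1) = -(∑ j, zeroMap g k w j * g' j (w k)) / g k (w k) := by
    have h1 : HasDerivAt (fun t => h (update w k t)) (D (Pi.single k 1)) (w k) := by
      have h2 : HasFDerivAt h D (update w k (w k)) := by
        rw [update_eq_self]; exact hstrict.hasFDerivAt
      exact h2.comp_hasDerivAt (w k) (hasDerivAt_update w k (w k))
    have h3 : (fun t => h (update w k t)) =ᶠ[𝓝 (w k)]
        fun t => slicePoint (fun j => g j t) k 0 w := by
      have : ∀ᶠ t in 𝓝 (w k), g k t ≠ 0 := (hg k).continuous.continuousAt.eventually_ne hw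
      filter_upwards [this] with t ht
      simp only [hh, update_self]
      exact slicePoint_update (c := fun j => g j t) ht t 0 w
    exact h1.unique ((hasDerivAt_slicePoint hd hw w).congr_of_eventuallyEq h3)
  have hT : zeroMap g k = fun w => w + (h w - w k) • Pi.single (M := fun _ => ℝ) k (1 : ℝ) := by
    ext w j
    rcases eq_or_ne j k with rfl | hj
    · simp [zeroMap, hh]
    · simp [zeroMap, update_of_ne hj, Pi.single_eq_of_ne hj]
  have hproj : HasStrictFDerivAt (fun w : ι → ℝ => w k)
      (ContinuousLinearMap.proj (R := ℝ) (φ := fun _ : ι => ℝ) k) w :=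
    (ContinuousLinearMap.proj (R := ℝ) (φ := fun _ : ι => ℝ) k).hasStrictFDerivAt
  refine ⟨ContinuousLinearMap.id ℝ (ι → ℝ) +
    (D - ContinuousLinearMap.proj (R := ℝ) (φ := fun _ : ι => ℝ) k).smulRight
      (Pi.single k (1 : ℝ)), ?_, ?_⟩
  · rw [hT]
    exact (hasStrictFDerivAt_id w).add ((hstrict.sub hproj).smul_const _)
  · have hlin : ((ContinuousLinearMap.id ℝ (ι → ℝ) +
        (D - ContinuousLinearMap.proj (R := ℝ) (φ := fun _ : ι => ℝ) k).smulRight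
          (Pi.single k (1 : ℝ)) : (ι → ℝ) →L[ℝ] (ι → ℝ)) : (ι → ℝ) →ₗ[ℝ] (ι → ℝ))
        = LinearMap.transvection ((D - ContinuousLinearMap.proj (R := ℝ) (φ := fun _ : ι => ℝ) k :
          (ι → ℝ) →L[ℝ] ℝ) : (ι → ℝ) →ₗ[ℝ] ℝ) (Pi.single k (1 : ℝ)) := rfl
    rw [ContinuousLinearMap.det, hlin, LinearMap.transvection.det, ← hline]
    simp

/-- A point of the fibre over y agrees with y off `k`, and its k-th entry is a zero of ∑ y_j g_j.
Thus the multiplicity in the area formula is the number of zeros. -/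
lemma encard_zeroMap_fibre {g : ι → ℝ → ℝ} {k : ι} {S : Set ℝ} (hS : ∀ x ∈ S, g k x ≠ 0)
    (y : ι → ℝ) :
    ({w | w k ∈ S} ∩ zeroMap g k ⁻¹' {y}).encard = {x | x ∈ S ∧ ∑ j, y j * g j x = 0}.encard := by
  have hinj : Injective fun x : ℝ => update y k x := update_injective y k
  rw [← hinj.encard_image]
  congr 1
  ext w
  constructor
  · rintro ⟨hw, hwy⟩
    have hwy' : zeroMap g k w = y := hwy
    refine ⟨w k, ⟨hw, ?_⟩, ?_⟩
    · rw [← hwy']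
      exact sum_update_slicePoint (c := fun j => g j (w k)) (hS _ hw) 0 w
    · rw [← hwy']
      simp [zeroMap]
  · rintro ⟨x, ⟨hx, hx0⟩, rfl⟩
    refine ⟨by simpa using hx, ?_⟩
    show zeroMap g k (update y k x) = y
    rw [zeroMap_update (hS x hx), slicePoint, hx0]
    simp

variable {ν : Measure ℝ} [IsProbabilityMeasure ν] {p : ℝ → ℝ}

lemma measurable_zeroMap {g : ι → ℝ → ℝ} (hg : ∀ j, ContDiff ℝ 1 (g j)) (k : ι) :
    Measurable (zeroMap g k) := by
  have hgm : ∀ j, Measurable (g j) := fun j => (hg j).continuous.measurable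
  have h1 : Measurable fun w : ι → ℝ => slicePoint (fun j => g j (w k)) k 0 w := by
    unfold slicePoint
    fun_prop
  exact (measurable_update_prod k).comp (h1.prodMk measurable_id)

lemma measurable_of_hasDerivAt {g g' : ℝ → ℝ} (hd : ∀ x, HasDerivAt g (g' x) x) :
    Measurable g' := by
  have : g' = deriv g := funext fun x => (hd x).deriv.symm
  rw [this]
  exact measurable_deriv _

/-- The Jacobian determinant of `zeroMap`. -/
noncomputable def zeroMapJacobian (g g' : ι → ℝ → ℝ) (k : ι) (w : ι → ℝ) : ℝ :=
  -(∑ j, zeroMap g k w j * g' j (w k)) / g k (w k)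

lemma measurable_zeroMapJacobian {g g' : ι → ℝ → ℝ} (hg : ∀ j, ContDiff ℝ 1 (g j))
    (hd : ∀ j x, HasDerivAt (g j) (g' j x) x) (k : ι) : Measurable (zeroMapJacobian g g' k) := by
  have hgm : ∀ j, Measurable (g j) := fun j => (hg j).continuous.measurable
  have hg'm : ∀ j, Measurable (g' j) := fun j => measurable_of_hasDerivAt (hd j)
  have : ∀ j, Measurable fun w => zeroMap g k w j := fun j =>
    (measurable_pi_apply j).comp (measurable_zeroMap hg k)
  unfold zeroMapJacobian
  exact ((Finset.measurable_sum _ fun j _ =>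
    (this j).mul ((hg'm j).comp (measurable_pi_apply k))).neg).div
      ((hgm k).comp (measurable_pi_apply k))

lemma area_formula_zeroMap {g g' : ι → ℝ → ℝ}
    (hg : ∀ j, ContDiff ℝ 1 (g j)) (hd : ∀ j x, HasDerivAt (g j) (g' j x) x) {k : ι} {S : Set ℝ}
    (hSm : MeasurableSet S) (hS : ∀ x ∈ S, g k x ≠ 0) :
    AEMeasurable (fun v : ι → ℝ => ({x | x ∈ S ∧ ∑ j, v j * g j x = 0}.encard : ℝ≥0∞)) ∧
      ∀ W : (ι → ℝ) → ℝ≥0∞, Measurable W →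
        ∫⁻ v, ({x | x ∈ S ∧ ∑ j, v j * g j x = 0}.encard : ℝ≥0∞) * W v
          = ∫⁻ w in {w | w k ∈ S},
              ENNReal.ofReal |zeroMapJacobian g g' k w| * W (zeroMap g k w) := by
  set s : Set (ι → ℝ) := {w | w k ∈ S} with hs
  have hsm : MeasurableSet s := hSm.preimage (measurable_pi_apply k)
  have hex : ∀ w : ι → ℝ, ∃ T' : (ι → ℝ) →L[ℝ] (ι → ℝ), w ∈ s →
      HasStrictFDerivAt (zeroMap g k) T' w ∧ T'.det = zeroMapJacobian g g' k w := by
    intro w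
    by_cases hw : w ∈ s
    · obtain ⟨T', h1, h2⟩ := exists_hasStrictFDerivAt_zeroMap hg hd (hS (w k) hw)
      exact ⟨T', fun _ => ⟨h1, h2⟩⟩
    -- Outside `s` the derivative gets the junk value 0.
    · exact ⟨0, fun h => absurd h hw⟩
  choose T' hT' using hex
  have hdet : MeasurableSet {w ∈ s | (T' w).det = 0} := by
    have : {w ∈ s | (T' w).det = 0} = s ∩ zeroMapJacobian g g' k ⁻¹' {0} := by
      ext w
      simp only [mem_ofPred_eq, mem_inter_iff, mem_preimage, mem_singleton_iff]
      exact and_congr_right fun hw => by rw [(hT' w hw).2]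
    rw [this]
    exact hsm.inter (measurable_zeroMapJacobian hg hd k (measurableSet_singleton 0))
  obtain ⟨hmeas, harea⟩ := area_formula (volume : Measure (ι → ℝ)) hsm
    (fun w hw => (hT' w hw).1) hdet
  simp_rw [hs, encard_zeroMap_fibre hS] at hmeas harea
  refine ⟨hmeas, fun W hW => ?_⟩
  rw [harea W hW]
  exact setLIntegral_congr_fun hsm fun w hw => by rw [(hT' w hw).2]

lemma lintegral_pi_ite_erase (k : ι) {Φ : (ι → ℝ) → ℝ≥0∞} (hΦ : Measurable Φ) :
    ∫⁻ w, Φ w ∂(Measure.pi fun i => if i ∈ Finset.univ.erase k then ν else volume)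
      = ∫⁻ x, ∫⁻ v, Φ (update v k x) ∂(Measure.pi fun _ : ι => ν) := by
  have hu : update (fun i => if i ∈ Finset.univ.erase k then ν else (volume : Measure ℝ)) k ν
      = fun _ => ν := by
    ext1 i
    rcases eq_or_ne i k with rfl | hi
    · simp
    · simp [hi]
  have inst : ∀ i, SigmaFinite
      (update (fun i => if i ∈ Finset.univ.erase k then ν else (volume : Measure ℝ)) k ν i) := by
    rw [hu]; infer_instance
  rw [lintegral_pi_eq_lintegral_update _ ν k hΦ, hu]
  simp only [Finset.mem_erase, ne_eq, not_true_eq_false, false_and, if_false]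

/-- The Kac–Rice formula on a set where a fixed `g_k` does not vanish. -/
theorem kacRice_of_ne_zero (hp : Measurable p)
    (hν : ν = volume.withDensity fun x => ENNReal.ofReal (p x)) {g g' : ι → ℝ → ℝ}
    (hg : ∀ j, ContDiff ℝ 1 (g j)) (hd : ∀ j x, HasDerivAt (g j) (g' j x) x) {k : ι} {S : Set ℝ}
    (hSm : MeasurableSet S) (hS : ∀ x ∈ S, g k x ≠ 0) :
    AEMeasurable (fun v : ι → ℝ => ({x | x ∈ S ∧ ∑ j, v j * g j x = 0}.encard : ℝ≥0∞))
        (Measure.pi fun _ : ι => ν) ∧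
      ∫⁻ v, ({x | x ∈ S ∧ ∑ j, v j * g j x = 0}.encard : ℝ≥0∞) ∂(Measure.pi fun _ : ι => ν)
        = ∫⁻ x in S, sliceIntegral ν p (fun j => g j x) k
            (fun v => ENNReal.ofReal |∑ j, v j * g' j x|) 0 := by
  have hpi : (Measure.pi fun _ : ι => ν)
      = (volume : Measure (ι → ℝ)).withDensity fun v => ∏ j, ENNReal.ofReal (p (v j)) := by
    simpa using pi_ite_eq_withDensity (ι := ι) hp hν Finset.univ
  set s : Set (ι → ℝ) := {w | w k ∈ S} with hs
  have hsm : MeasurableSet s := hSm.preimage (measurable_pi_apply k)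
  obtain ⟨hmeas, harea⟩ := area_formula_zeroMap hg hd hSm hS
  have hac : (Measure.pi fun _ : ι => ν) ≪ (volume : Measure (ι → ℝ)) := by
    rw [hpi]; exact withDensity_absolutelyContinuous _ _
  refine ⟨hmeas.mono_ac hac, ?_⟩
  have hW : Measurable fun v : ι → ℝ => ∏ j, ENNReal.ofReal (p (v j)) := by fun_prop
  set Φ : (ι → ℝ) → ℝ≥0∞ := s.indicator fun w =>
    ENNReal.ofReal |zeroMapJacobian g g' k w| * ENNReal.ofReal (p (zeroMap g k w k)) with hΦ
  have hΦm : Measurable Φ := by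
    refine Measurable.indicator ?_ hsm
    exact ((measurable_zeroMapJacobian hg hd k).abs.ennreal_ofReal).mul
      (hp.comp ((measurable_pi_apply k).comp (measurable_zeroMap hg k))).ennreal_ofReal
  calc ∫⁻ v : ι → ℝ, ({x | x ∈ S ∧ ∑ j, v j * g j x = 0}.encard : ℝ≥0∞) ∂(Measure.pi fun _ : ι => ν)
      = ∫⁻ v : ι → ℝ, ({x | x ∈ S ∧ ∑ j, v j * g j x = 0}.encard : ℝ≥0∞) *
          ∏ j, ENNReal.ofReal (p (v j)) := by
        rw [hpi, lintegral_withDensity_eq_lintegral_mul₀ hW.aemeasurable hmeas]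
        refine lintegral_congr fun v => ?_
        rw [Pi.mul_apply, mul_comm]
    _ = ∫⁻ w in s, ENNReal.ofReal |zeroMapJacobian g g' k w| *
          ∏ j, ENNReal.ofReal (p (zeroMap g k w j)) :=
        harea _ hW
    -- The map fixes the other coordinates, so their densities rebuild `ν`; the k-th variable, now
    -- the position of a zero, stays Lebesgue.
    _ = ∫⁻ w : ι → ℝ, (∏ j ∈ Finset.univ.erase k, ENNReal.ofReal (p (w j))) * Φ w := by
        rw [← lintegral_indicator hsm]
        refine lintegral_congr fun w => ?_
        by_cases hw : w ∈ s
        · rw [hΦ, indicator_of_mem hw, indicator_of_mem hw,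
            ← Finset.mul_prod_erase _ _ (Finset.mem_univ k)]
          have : ∏ j ∈ Finset.univ.erase k, ENNReal.ofReal (p (zeroMap g k w j))
              = ∏ j ∈ Finset.univ.erase k, ENNReal.ofReal (p (w j)) :=
            Finset.prod_congr rfl fun j hj => by
              rw [zeroMap, update_of_ne (Finset.ne_of_mem_erase hj)]
          rw [this, ← mul_assoc, mul_comm]
        · rw [hΦ, indicator_of_notMem hw, indicator_of_notMem hw, mul_zero]
    _ = ∫⁻ w : ι → ℝ, Φ w ∂(Measure.pi fun i => if i ∈ Finset.univ.erase k then ν else volume) := by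
        rw [pi_ite_eq_withDensity hp hν,
          lintegral_withDensity_eq_lintegral_mul _ (by fun_prop) hΦm]
        rfl
    _ = ∫⁻ x : ℝ, ∫⁻ v : ι → ℝ, Φ (update v k x) ∂(Measure.pi fun _ : ι => ν) :=
        lintegral_pi_ite_erase k hΦm
    _ = ∫⁻ x : ℝ, S.indicator (fun x => sliceIntegral ν p (fun j => g j x) k
            (fun v => ENNReal.ofReal |∑ j, v j * g' j x|) 0) x := by
        refine lintegral_congr fun x => ?_
        by_cases hx : x ∈ S
        · have hmem : ∀ v : ι → ℝ, update v k x ∈ s := fun v => by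
            rw [hs, mem_ofPred_eq, update_self]; exact hx
          rw [indicator_of_mem hx, sliceIntegral, ← lintegral_const_mul']
          · refine lintegral_congr fun v => ?_
            rw [hΦ, indicator_of_mem (hmem v), zeroMapJacobian, zeroMap_update (hS x hx),
              update_self, update_self, abs_div, abs_neg, div_eq_inv_mul,
              ENNReal.ofReal_mul (inv_nonneg.2 (abs_nonneg _)), mul_assoc]
          · exact ENNReal.ofReal_ne_top
        · have hmem : ∀ v : ι → ℝ, update v k x ∉ s := fun v => by
            rw [hs, mem_ofPred_eq, update_self]; exact hx
          rw [indicator_of_notMem hx]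
          simp_rw [hΦ, indicator_of_notMem (hmem _), lintegral_zero]
    _ = _ := lintegral_indicator hSm _

end KacRice

/-! ### The continuous joint density of two linear forms -/

section JointDensity

variable {ι : Type*} [Fintype ι] {p : ℝ → ℝ}

lemma continuous_integral_mul_of_bounded {π : Measure (ι → ℝ)} [IsFiniteMeasure π]
    (hp : Continuous p) {M : ℝ} (hM : ∀ x, |p x| ≤ M)
    {α β : ℝ × ℝ → (ι → ℝ) → ℝ} (hα : ∀ z, Continuous (α z)) (hβ : ∀ z, Continuous (β z))
    (hα' : ∀ v, Continuous fun z => α z v) (hβ' : ∀ v, Continuous fun z => β z v) :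
    Continuous fun z => ∫ v, p (α z v) * p (β z v) ∂π := by
  refine continuous_of_dominated (bound := fun _ => M * M) ?_ ?_ (integrable_const _) ?_
  · intro z
    exact ((hp.comp (hα z)).mul (hp.comp (hβ z))).aestronglyMeasurable
  · intro z
    refine Eventually.of_forall fun v => ?_
    rw [norm_mul, Real.norm_eq_abs, Real.norm_eq_abs]
    exact mul_le_mul (hM _) (hM _) (abs_nonneg _) ((abs_nonneg _).trans (hM 0))
  · exact Eventually.of_forall fun v => (hp.comp (hα' v)).mul (hp.comp (hβ' v))

/-- Otherwise g' is a multiple of g and the Gram determinant vanishes. -/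
lemma exists_sub_div_mul_ne_zero {g g' : ι → ℝ} {k : ι}
    (h : (∑ j, g' j ^ 2) * (∑ j, g j ^ 2) - (∑ j, g j * g' j) ^ 2 ≠ 0) :
    ∃ l, g' l - g' k / g k * g l ≠ 0 := by
  by_contra! hno
  apply h
  have h' : ∀ j, g' j = g' k / g k * g j := fun j => sub_eq_zero.1 (hno j)
  have e1 : ∑ j, g' j ^ 2 = (g' k / g k) ^ 2 * ∑ j, g j ^ 2 := by
    rw [Finset.mul_sum]
    exact Finset.sum_congr rfl fun j _ => by rw [h' j, mul_pow]
  have e2 : ∑ j, g j * g' j = (g' k / g k) * ∑ j, g j ^ 2 := by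
    rw [Finset.mul_sum]
    exact Finset.sum_congr rfl fun j _ => by rw [h' j]; ring
  rw [e1, e2]
  ring

variable [DecidableEq ι] {ν : Measure ℝ} [IsProbabilityMeasure ν]

/-- The continuous conditional density of `∑ v_j g'_j` on the slices `∑ v_j g_j = x`. -/
theorem exists_continuous_density_sliceIntegral (hp : Continuous p) (hp0 : ∀ x, 0 ≤ p x)
    {M : ℝ} (hM : ∀ x, p x ≤ M)
    (hν : ν = volume.withDensity fun x => ENNReal.ofReal (p x)) {g g' : ι → ℝ} {k l : ι}
    (hk : g k ≠ 0) (hl : g' l - g' k / g k * g l ≠ 0) :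
    ∃ D : ℝ × ℝ → ℝ, Continuous D ∧ (∀ z, 0 ≤ D z) ∧
      ∀ (x : ℝ) (Φ : ℝ → ℝ≥0∞), Measurable Φ →
        sliceIntegral ν p g k (fun v => Φ (∑ j, v j * g' j)) x
          = ∫⁻ y, Φ y * ENNReal.ofReal (D (x, y)) := by
  set π := Measure.pi fun _ : ι => ν with hπ
  set τ := g' k / g k with hτ
  -- Gaussian elimination: the form e does not involve v_k, so the system is triangular. Level y for
  -- g' and x for g means level y - τ x for e; `β` solves it for v_l, then `α` solves for v_k.
  set e : ι → ℝ := fun j => g' j - τ * g j with he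
  have hek : e k = 0 := by
    simp only [he, hτ]
    field_simp
    ring
  have hel : e l ≠ 0 := hl
  set β : ℝ × ℝ → (ι → ℝ) → ℝ := fun z v => slicePoint e l (z.2 - τ * z.1) v with hβ
  set α : ℝ × ℝ → (ι → ℝ) → ℝ := fun z v => slicePoint g k z.1 (update v l (β z v)) with hα
  have hβv : ∀ z, Continuous (β z) := fun z => by
    simp only [hβ]; unfold slicePoint; fun_prop
  have hβz : ∀ v, Continuous fun z => β z v := fun v => by
    simp only [hβ]; unfold slicePoint; fun_prop
  have hαv : ∀ z, Continuous (α z) := fun z =>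
    (continuous_slicePoint g k).comp (continuous_const.prodMk (continuous_id.update l (hβv z)))
  have hαz : ∀ v, Continuous fun z => α z v := fun v =>
    (continuous_slicePoint g k).comp (continuous_fst.prodMk (continuous_const.update l (hβz v)))
  have hM0 : 0 ≤ M := (hp0 0).trans (hM 0)
  set D : ℝ × ℝ → ℝ := fun z => |g k|⁻¹ * (|e l|⁻¹ * ∫ v, p (α z v) * p (β z v) ∂π) with hD
  have hDlint : ∀ z, ENNReal.ofReal (D z) = ENNReal.ofReal |g k|⁻¹ *
      sliceIntegral ν p e l (fun v => ENNReal.ofReal (p (slicePoint g k z.1 v)))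
        (z.2 - τ * z.1) := by
    intro z
    have hcont : Continuous fun v => p (α z v) * p (β z v) :=
      (hp.comp (hαv z)).mul (hp.comp (hβv z))
    have hint : Integrable (fun v => p (α z v) * p (β z v)) π := by
      refine (integrable_const (M * M)).mono' hcont.aestronglyMeasurable
        (Eventually.of_forall fun v => ?_)
      rw [Real.norm_of_nonneg (mul_nonneg (hp0 _) (hp0 _))]
      exact mul_le_mul (hM _) (hM _) (hp0 _) hM0
    simp only [hD]
    rw [ENNReal.ofReal_mul (by positivity), ENNReal.ofReal_mul (by positivity),
      ofReal_integral_eq_lintegral_ofReal hint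
        (Eventually.of_forall fun v => mul_nonneg (hp0 _) (hp0 _)), sliceIntegral]
    congr 2
    refine lintegral_congr fun v => ?_
    rw [ENNReal.ofReal_mul (hp0 _)]
  refine ⟨D, ?_, ?_, ?_⟩
  · exact continuous_const.mul (continuous_const.mul
      (continuous_integral_mul_of_bounded hp (M := M)
        (fun x => by rw [abs_of_nonneg (hp0 x)]; exact hM x) hαv hβv hαz hβz))
  · intro z
    have : 0 ≤ ∫ v, p (α z v) * p (β z v) ∂π :=
      integral_nonneg fun v => mul_nonneg (hp0 _) (hp0 _)
    positivity
  · intro x Φ hΦ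
    have hsum : ∀ v : ι → ℝ, ∑ j, update v k (slicePoint g k x v) j * g' j
        = ∑ j, v j * e j + τ * x := by
      intro v
      have h1 : ∑ j, update v k (slicePoint g k x v) j * g' j
          = ∑ j, update v k (slicePoint g k x v) j * e j
            + τ * ∑ j, update v k (slicePoint g k x v) j * g j := by
        rw [Finset.mul_sum, ← Finset.sum_add_distrib]
        exact Finset.sum_congr rfl fun j _ => by simp only [he]; ring
      rw [h1, sum_update_slicePoint hk, sum_update_mul, hek]
      ring
    have hsm : Measurable (slicePoint g k x) :=
      (continuous_slicePoint g k).measurable.comp measurable_prodMk_left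
    have hDm : Measurable fun y => sliceIntegral ν p e l
        (fun v => ENNReal.ofReal (p (slicePoint g k x v))) y :=
      measurable_sliceIntegral hp.measurable (hp.measurable.comp hsm).ennreal_ofReal
    have hpull : ∀ (c : ℝ≥0∞) (y : ℝ), sliceIntegral ν p e l
        (fun v => c * ENNReal.ofReal (p (slicePoint g k x v))) y
        = c * sliceIntegral ν p e l (fun v => ENNReal.ofReal (p (slicePoint g k x v))) y := by
      intro c y
      have hu : Measurable fun v : ι → ℝ => update v l (slicePoint e l y v) :=
        (continuous_update_slicePoint e l).measurable.comp measurable_prodMk_left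
      have hs : Measurable fun v : ι → ℝ => slicePoint e l y v :=
        (continuous_slicePoint e l).measurable.comp measurable_prodMk_left
      unfold sliceIntegral
      simp_rw [mul_assoc c]
      rw [lintegral_const_mul _ (by
        exact (hp.measurable.comp (hsm.comp hu)).ennreal_ofReal.mul
          (hp.measurable.comp hs).ennreal_ofReal)]
      ring
    have hstep := lintegral_pi_eq_lintegral_sliceIntegral (ν := ν) hp.measurable hν hel
      (H := fun y v => Φ (y + τ * x) * ENNReal.ofReal (p (slicePoint g k x v)))
      (by
        exact (hΦ.comp (measurable_fst.add_const _)).mul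
          (hp.measurable.comp (hsm.comp measurable_snd)).ennreal_ofReal)
    simp_rw [hpull] at hstep
    conv_lhs => unfold sliceIntegral
    simp_rw [hsum]
    rw [hstep, ← lintegral_sub_right_eq_self _ (τ * x), ← lintegral_const_mul _ (by fun_prop)]
    refine lintegral_congr fun y => ?_
    rw [hDlint, sub_add_cancel]
    ring

/-- The continuous joint density of two linearly independent linear forms. -/
theorem exists_joint_density (hp : Continuous p) (hp0 : ∀ x, 0 ≤ p x)
    {M : ℝ} (hM : ∀ x, p x ≤ M)
    (hν : ν = volume.withDensity fun x => ENNReal.ofReal (p x)) {g g' : ι → ℝ} {k : ι}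
    (hk : g k ≠ 0) (h : (∑ j, g' j ^ 2) * (∑ j, g j ^ 2) - (∑ j, g j * g' j) ^ 2 ≠ 0) :
    ∃ D : ℝ × ℝ → ℝ, Continuous D ∧ (∀ z, 0 ≤ D z) ∧
      (Measure.pi fun _ : ι => ν).map (fun v => (∑ j, v j * g j, ∑ j, v j * g' j))
        = volume.withDensity (fun z => ENNReal.ofReal (D z)) ∧
      sliceIntegral ν p g k (fun v => ENNReal.ofReal |∑ j, v j * g' j|) 0
        = ∫⁻ y, ENNReal.ofReal (|y| * D (0, y)) := by
  obtain ⟨l, hl⟩ := exists_sub_div_mul_ne_zero (k := k) h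
  obtain ⟨D, hD, hD0, hDs⟩ := exists_continuous_density_sliceIntegral (ν := ν) hp hp0 hM hν hk hl
  refine ⟨D, hD, hD0, ?_, ?_⟩
  · refine Measure.ext_of_lintegral _ fun F hF => ?_
    have hDm : Measurable fun z => ENNReal.ofReal (D z) := hD.measurable.ennreal_ofReal
    rw [lintegral_map hF (by fun_prop), lintegral_withDensity_eq_lintegral_mul _ hDm hF,
      lintegral_pi_eq_lintegral_sliceIntegral hp.measurable hν hk
        (H := fun x v => F (x, ∑ j, v j * g' j)) (by
          exact hF.comp (measurable_fst.prodMk (by fun_prop))),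
      Measure.volume_eq_prod, lintegral_prod _ (hDm.mul hF).aemeasurable]
    refine lintegral_congr fun x => ?_
    rw [hDs x (fun y => F (x, y)) (hF.comp measurable_prodMk_left)]
    exact lintegral_congr fun y => mul_comm _ _
  · rw [hDs 0 (fun y => ENNReal.ofReal |y|) (by fun_prop)]
    exact lintegral_congr fun y => (ENNReal.ofReal_mul (abs_nonneg _)).symm

end JointDensity

/-! ### Gluing over the choice of the solved coordinate -/

section ZeroDensity

variable {n : ℕ}

/-- The points at which `g_k` is the first of the functions `g_j` that does not vanish. -/
def firstNonzero (g : Fin n → ℝ → ℝ) (k : Fin n) : Set ℝ :=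
  {x | g k x ≠ 0 ∧ ∀ j < k, g j x = 0}

lemma measurableSet_firstNonzero {g : Fin n → ℝ → ℝ} (hg : ∀ j, ContDiff ℝ 1 (g j))
    (k : Fin n) : MeasurableSet (firstNonzero g k) := by
  have h : firstNonzero g k = (g k ⁻¹' {0}ᶜ) ∩ ⋂ j, ⋂ (_ : j < k), g j ⁻¹' {0} := by
    ext x; simp [firstNonzero]
  have hm : ∀ j, Measurable (g j) := fun j => (hg j).continuous.measurable
  rw [h]
  exact (hm k (measurableSet_singleton 0).compl).inter
    (MeasurableSet.iInter fun j => MeasurableSet.iInter fun _ => hm j (measurableSet_singleton 0))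

lemma pairwise_disjoint_firstNonzero (g : Fin n → ℝ → ℝ) :
    Pairwise (Function.onFun Disjoint (firstNonzero g)) := by
  intro i j hij
  refine Set.disjoint_left.2 fun x hi hj => ?_
  rcases lt_or_gt_of_ne hij with h | h
  · exact hi.1 (hj.2 i h)
  · exact hj.1 (hi.2 j h)

lemma exists_mem_firstNonzero {g : Fin n → ℝ → ℝ} {x : ℝ} (h : ∑ j, g j x ^ 2 ≠ 0) :
    ∃ k, x ∈ firstNonzero g k := by
  have h1 : ∃ k, g k x ≠ 0 := by
    by_contra! h0
    exact h (Finset.sum_eq_zero fun j _ => by rw [h0 j]; norm_num)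
  obtain ⟨k, hk, hmin⟩ := WellFounded.has_min (wellFounded_lt (α := Fin n)) {k | g k x ≠ 0} h1
  exact ⟨k, hk, fun j hj => by_contra fun h0 => hmin j h0 hj⟩

/-- The Kac–Rice intensity of the zeros of `∑ η_j g_j`. -/
noncomputable def zeroDensity (ν : Measure ℝ) (p : ℝ → ℝ) (g g' : Fin n → ℝ → ℝ) (x : ℝ) : ℝ :=
  ∑ k, (firstNonzero g k).indicator (fun x => (sliceIntegral ν p (fun j => g j x) k
    (fun v => ENNReal.ofReal |∑ j, v j * g' j x|) 0).toReal) x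

variable {ν : Measure ℝ} {p : ℝ → ℝ} {g g' : Fin n → ℝ → ℝ}

lemma zeroDensity_nonneg (x : ℝ) : 0 ≤ zeroDensity ν p g g' x :=
  Finset.sum_nonneg fun _ _ => indicator_nonneg (fun _ _ => ENNReal.toReal_nonneg) x

lemma zeroDensity_eq_of_mem {k : Fin n} {x : ℝ} (hx : x ∈ firstNonzero g k) :
    zeroDensity ν p g g' x = (sliceIntegral ν p (fun j => g j x) k
      (fun v => ENNReal.ofReal |∑ j, v j * g' j x|) 0).toReal := by
  unfold zeroDensity
  rw [Finset.sum_eq_single k, indicator_of_mem hx]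
  · intro j _ hj
    exact indicator_of_notMem
      (fun h => (pairwise_disjoint_firstNonzero g hj).notMem_of_mem_left h hx) _
  · simp

variable [IsProbabilityMeasure ν]

lemma measurable_zeroDensity (hp : Measurable p) (hg : ∀ j, ContDiff ℝ 1 (g j))
    (hd : ∀ j x, HasDerivAt (g j) (g' j x) x) : Measurable (zeroDensity ν p g g') := by
  have hgm : ∀ j, Measurable (g j) := fun j => (hg j).continuous.measurable
  have hg'm : ∀ j, Measurable (g' j) := fun j => measurable_of_hasDerivAt (hd j)
  unfold zeroDensity
  refine Finset.measurable_sum _ fun k _ => ?_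
  refine Measurable.indicator (Measurable.ennreal_toReal ?_) (measurableSet_firstNonzero hg k)
  unfold sliceIntegral
  have hs : Measurable fun z : ℝ × (Fin n → ℝ) => slicePoint (fun j => g j z.1) k 0 z.2 := by
    unfold slicePoint
    fun_prop
  have hu : Measurable fun z : ℝ × (Fin n → ℝ) =>
      update z.2 k (slicePoint (fun j => g j z.1) k 0 z.2) :=
    (measurable_update_prod k).comp (hs.prodMk measurable_snd)
  have hsum : Measurable fun z : ℝ × (Fin n → ℝ) =>
      ∑ j, update z.2 k (slicePoint (fun j => g j z.1) k 0 z.2) j * g' j z.1 :=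
    Finset.measurable_sum _ fun j _ =>
      ((measurable_pi_apply j).comp hu).mul ((hg'm j).comp measurable_fst)
  exact (hgm k).abs.inv.ennreal_ofReal.mul
    (hsum.abs.ennreal_ofReal.mul (hp.comp hs).ennreal_ofReal).lintegral_prod_right'

/-- The Kac–Rice formula for random sums with independent coefficients of law `ν`. -/
theorem kacRice (hp : Measurable p)
    (hν : ν = volume.withDensity fun x => ENNReal.ofReal (p x))
    (hg : ∀ j, ContDiff ℝ 1 (g j)) (hd : ∀ j x, HasDerivAt (g j) (g' j x) x)
    (hfin : ∀ (k : Fin n) (x : ℝ), g k x ≠ 0 → sliceIntegral ν p (fun j => g j x) k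
      (fun v => ENNReal.ofReal |∑ j, v j * g' j x|) 0 ≠ ∞)
    {S : Set ℝ} (hSm : MeasurableSet S) (hS : ∀ x ∈ S, ∑ j, g j x ^ 2 ≠ 0) :
    AEMeasurable (fun v : Fin n → ℝ => ({x | x ∈ S ∧ ∑ j, v j * g j x = 0}.encard : ℝ≥0∞))
        (Measure.pi fun _ : Fin n => ν) ∧
      ∫⁻ v, ({x | x ∈ S ∧ ∑ j, v j * g j x = 0}.encard : ℝ≥0∞) ∂(Measure.pi fun _ : Fin n => ν)
        = ∫⁻ x in S, ENNReal.ofReal (zeroDensity ν p g g' x) := by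
  -- Since ∑ g_j² ≠ 0 on `S`, some coordinate can be solved for at each point; taking the first one
  -- gives a finite measurable partition.
  set A : Fin n → Set ℝ := fun k => S ∩ firstNonzero g k with hA
  have hAm : ∀ k, MeasurableSet (A k) := fun k => hSm.inter (measurableSet_firstNonzero hg k)
  have hAd : Pairwise (Function.onFun Disjoint A) := fun i j hij =>
    (pairwise_disjoint_firstNonzero g hij).mono inter_subset_right inter_subset_right
  have hAU : ⋃ k, A k = S := by
    rw [← inter_iUnion, inter_eq_left]
    exact fun x hx => mem_iUnion.2 (exists_mem_firstNonzero (hS x hx))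
  have hAg : ∀ k, ∀ x ∈ A k, g k x ≠ 0 := fun k x hx => hx.2.1
  have hcount : ∀ v : Fin n → ℝ, ({x | x ∈ S ∧ ∑ j, v j * g j x = 0}.encard : ℝ≥0∞)
      = ∑ k, ({x | x ∈ A k ∧ ∑ j, v j * g j x = 0}.encard : ℝ≥0∞) := by
    intro v
    have hU : {x | x ∈ S ∧ ∑ j, v j * g j x = 0}
        = ⋃ k, {x | x ∈ A k ∧ ∑ j, v j * g j x = 0} := by
      ext x
      rw [← hAU]
      simp only [mem_iUnion, mem_ofPred_eq, exists_and_right]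
    rw [hU, encard_iUnion_eq_tsum, tsum_fintype]
    intro i j hij
    exact (hAd hij).mono (fun x hx => hx.1) fun x hx => hx.1
  have hk := fun k => kacRice_of_ne_zero hp hν hg hd (hAm k) (hAg k)
  simp_rw [hcount]
  refine ⟨Finset.aemeasurable_fun_sum _ fun k _ => (hk k).1, ?_⟩
  rw [lintegral_finsetSum' _ fun k _ => (hk k).1]
  conv_rhs => rw [← hAU, lintegral_iUnion hAm hAd, tsum_fintype]
  refine Finset.sum_congr rfl fun k _ => ?_
  rw [(hk k).2]
  refine setLIntegral_congr_fun (hAm k) fun x hx => ?_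
  rw [zeroDensity_eq_of_mem hx.2, ENNReal.ofReal_toReal (hfin k x (hAg k x hx))]

end ZeroDensity

/-! ### Comparison with the stated constants -/

section Constants

lemma one_le_k₄ : 1 ≤ RandomSum.k₄ := by
  unfold RandomSum.k₄
  have h2 : (1.41 : ℝ) ≤ √2 := Real.le_sqrt_of_sq_le (by norm_num)
  have h3 : (1.7 : ℝ) ≤ √3 := Real.le_sqrt_of_sq_le (by norm_num)
  have hpi := Real.pi_gt_d2
  have hlog : (2 : ℝ) ≤ Real.log 8 := by
    rw [show (8 : ℝ) = 2 ^ 3 by norm_num, Real.log_pow]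
    have := Real.log_two_gt_d9
    push_cast
    linarith
  have h4 : (5.3 : ℝ) ≤ Real.pi * √3 := by nlinarith
  nlinarith

lemma k₁_nonneg : 0 ≤ RandomSum.k₁ := by
  unfold RandomSum.k₁
  have h1 := Real.log_two_lt_d9
  have h2 : 0 ≤ Real.log 8 := Real.log_nonneg (by norm_num)
  have h3 : 0 ≤ 1 - Real.log 2 := by linarith
  have := Real.pi_pos
  positivity

lemma k₂_nonneg : 0 ≤ RandomSum.k₂ := by
  unfold RandomSum.k₂
  have h2 : 0 ≤ Real.log 8 := Real.log_nonneg (by norm_num)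
  have := Real.pi_pos
  positivity

lemma k₃_nonneg : 0 ≤ RandomSum.k₃ := by
  unfold RandomSum.k₃
  have h1 := Real.log_two_lt_d9
  have h3 : 0 ≤ 1 - Real.log 2 := by linarith
  positivity

lemma sqrt_three_div_sqrt_le {b C₂ C₃ : ℝ} (hb : 0 < b) (hb' : b ≤ 9 / 17) (hC₂ : 1 ≤ C₂)
    (hC₃ : 0 ≤ C₃) :
    √3 / √b ≤ 1 / b * (RandomSum.k₁ + C₃ * RandomSum.k₂ +
      1 / √b * (C₂ * (RandomSum.k₃ + C₂ * RandomSum.k₄))) := by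
  have h1 := k₁_nonneg
  have h2 := mul_nonneg hC₃ k₂_nonneg
  have h3 := k₃_nonneg
  have h4 := one_le_k₄
  have hsb := Real.sqrt_pos.2 hb
  have h5 : 1 ≤ C₂ * (RandomSum.k₃ + C₂ * RandomSum.k₄) := by
    have : 1 ≤ C₂ * RandomSum.k₄ := one_le_mul_of_one_le_of_one_le hC₂ h4
    exact one_le_mul_of_one_le_of_one_le hC₂ (by linarith)
  -- √3 < 17/9, the reciprocal of the bound on b.
  have hs3 : √3 * b ≤ 1 := by
    have : √3 ≤ 17 / 9 := Real.sqrt_le_iff.2 ⟨by norm_num, by norm_num⟩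
    nlinarith [Real.sqrt_nonneg 3]
  calc √3 / √b = 1 / b * (1 / √b * (√3 * b)) := by field_simp
    _ ≤ 1 / b * (1 / √b * (C₂ * (RandomSum.k₃ + C₂ * RandomSum.k₄))) := by
        exact mul_le_mul_of_nonneg_left
          (mul_le_mul_of_nonneg_left (hs3.trans h5) (by positivity)) (by positivity)
    _ ≤ _ := by
        gcongr
        linarith

end Constants

/-! ### Constraints imposed by unit variance -/

section CharFun

variable {ν : Measure ℝ} [IsProbabilityMeasure ν]

/-- Variance one limits the curvature of the characteristic function at the origin. -/
lemma one_sub_le_norm_charFun (hmem : MemLp id 2 ν) (h2 : ∫ x, x ^ 2 ∂ν = 1) (s : ℝ) :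
    1 - s ^ 2 / 2 ≤ ‖charFun ν s‖ := by
  have hsq : Integrable (fun x : ℝ => x ^ 2) ν := hmem.integrable_sq
  have hcos : Integrable (fun x => Real.cos (s * x)) ν :=
    (integrable_const (1 : ℝ)).mono' (by fun_prop)
      (Eventually.of_forall fun x => Real.abs_cos_le_one _)
  have hre : (charFun ν s).re = ∫ x, Real.cos (s * x) ∂ν := by
    rw [charFun_apply_real, ← RCLike.re_eq_complex_re, ← integral_re]
    · refine integral_congr_ae (Eventually.of_forall fun x => ?_)
      simp only [RCLike.re_eq_complex_re]
      rw [← Complex.ofReal_mul, Complex.exp_ofReal_mul_I_re]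
    · refine (integrable_const (1 : ℝ)).mono' (by fun_prop) (Eventually.of_forall fun x => ?_)
      rw [← Complex.ofReal_mul, Complex.norm_exp_ofReal_mul_I]
  calc 1 - s ^ 2 / 2 = ∫ x, (1 - s ^ 2 / 2 * x ^ 2) ∂ν := by
        rw [integral_sub (integrable_const _) (hsq.const_mul _), integral_const_mul, h2]
        simp
    _ ≤ ∫ x, Real.cos (s * x) ∂ν := by
        refine integral_mono ((integrable_const _).sub (hsq.const_mul _)) hcos fun x => ?_
        have := Real.one_sub_sq_div_two_le_cos (x := s * x)
        simp only
        nlinarith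
    _ ≤ ‖charFun ν s‖ := by rw [← hre]; exact Complex.re_le_norm _

lemma le_of_norm_charFun_le {b : ℝ} (hb : 0 < b) (hmem : MemLp id 2 ν)
    (h2 : ∫ x, x ^ 2 ∂ν = 1) (h : ∀ s, ‖charFun ν s‖ ≤ 1 / (1 + b * s ^ 2)) : b ≤ 9 / 17 := by
  -- Comparing the bounds at s = 1/3 gives (17/18)(1 + b/9) ≤ 1, that is b ≤ 9/17. Letting s → 0
  -- would give 1/2, but this suffices.
  have h1 := (one_sub_le_norm_charFun hmem h2 (1 / 3)).trans (h (1 / 3))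
  rw [le_div_iff₀ (by positivity)] at h1
  linarith

/-- The second derivative at 0 is minus the second moment; hence any bound on |φ''| is at least one.
-/
lemma norm_iteratedDeriv_two_charFun_zero (hmem : MemLp id 2 ν) (h2 : ∫ x, x ^ 2 ∂ν = 1) :
    ‖iteratedDeriv 2 (charFun ν) 0‖ = 1 := by
  rw [iteratedDeriv_charFun_zero (by exact_mod_cast hmem)]
  simp [h2]

end CharFun

/-! ### Transfer to the random sums and conclusion -/

section RandomSums

variable {Ω : Type*} {n : ℕ} {η : Fin (n + 1) → Ω → ℝ} {f : Fin (n + 1) → ℂ → ℂ}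

lemma P_ofReal (hreal : ∀ k, ∀ x : ℝ, (f k x).im = 0) (ω : Ω) (x : ℝ) :
    RandomSum.P η f ω x = ((∑ j, η j ω * (f j x).re : ℝ) : ℂ) := by
  unfold RandomSum.P
  push_cast
  refine Finset.sum_congr rfl fun j _ => ?_
  congr 1
  exact Complex.ext rfl (by simp [hreal j x])

lemma deriv_P_re (hf : ∀ k, Differentiable ℂ (f k)) (ω : Ω) (x : ℝ) :
    (deriv (RandomSum.P η f ω) x).re = ∑ j, η j ω * (deriv (f j) x).re := by
  have h : HasDerivAt (RandomSum.P η f ω) (∑ j, (η j ω : ℂ) * deriv (f j) x) (x : ℂ) :=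
    HasDerivAt.fun_sum fun j _ => ((hf j x).hasDerivAt).const_mul (η j ω : ℂ)
  rw [h.deriv, Complex.re_sum]
  exact Finset.sum_congr rfl fun j _ => Complex.re_ofReal_mul _ _

lemma zeroCount_eq (hreal : ∀ k, ∀ x : ℝ, (f k x).im = 0) (S : Set ℝ) (ω : Ω) :
    RandomSum.zeroCount η f S ω
      = ({x | x ∈ S ∧ ∑ j, η j ω * (f j x).re = 0}.encard : ℝ≥0∞) := by
  unfold RandomSum.zeroCount
  simp_rw [P_ofReal hreal, Complex.ofReal_eq_zero]

/-- Bernoulli's inequality, which needs q ≥ 1; afterwards a and q occur only through aq. -/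
lemma norm_le_one_div_one_add_mul_of_rpow {z : ℂ} {a q s : ℝ} (ha : 0 < a) (hq : 1 ≤ q)
    (h : ‖z‖ ≤ 1 / (1 + a * s ^ 2) ^ q) : ‖z‖ ≤ 1 / (1 + a * q * s ^ 2) := by
  have has : 0 ≤ a * s ^ 2 := by positivity
  have hq0 : 0 < q := by linarith
  refine h.trans (one_div_le_one_div_of_le (by positivity) ?_)
  have := one_add_mul_self_le_rpow_one_add (s := a * s ^ 2) (by linarith) hq
  linarith

variable [MeasurableSpace Ω] {μ : Measure Ω} {ν : Measure ℝ}
  [IsProbabilityMeasure ν] {p : ℝ → ℝ}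

/-- The Kac–Rice intensity is the density of the expected number of real zeros. -/
theorem isRealZeroDensity_zeroDensity (hη : ∀ k, Measurable (η k))
    (hlaw : μ.map (fun ω j => η j ω) = Measure.pi fun _ => ν)
    (hf : ∀ k, Differentiable ℂ (f k)) (hreal : ∀ k, ∀ x : ℝ, (f k x).im = 0)
    (hp : Continuous p) (hp0 : ∀ x, 0 ≤ p x) {M : ℝ} (hM : ∀ x, p x ≤ M)
    (hν : ν = volume.withDensity fun x => ENNReal.ofReal (p x))
    (hfin : ∀ (k : Fin (n + 1)) (x : ℝ), (f k x).re ≠ 0 →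
      sliceIntegral ν p (fun j => (f j x).re) k
        (fun v => ENNReal.ofReal |∑ j, v j * (deriv (f j) x).re|) 0 ≠ ∞) :
    RandomSum.IsRealZeroDensity μ η f
      (zeroDensity ν p (fun j (x : ℝ) => (f j x).re) fun j (x : ℝ) => (deriv (f j) x).re) := by
  have hg : ∀ j, ContDiff ℝ 1 fun x : ℝ => (f j x).re := fun j =>
    (hf j).contDiff.real_of_complex
  have hd : ∀ j, ∀ x : ℝ, HasDerivAt (fun x : ℝ => (f j x).re) (deriv (f j) x).re x :=
    fun j x => (hf j x).hasDerivAt.real_of_complex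
  have hηm : Measurable fun ω j => η j ω := measurable_pi_iff.2 hη
  refine ⟨measurable_zeroDensity hp.measurable hg hd, zeroDensity_nonneg, ?_, ?_, ?_⟩
  · intro S hSm hS
    simp_rw [funext (zeroCount_eq (η := η) hreal S)]
    have h1 := (kacRice hp.measurable hν hg hd hfin hSm hS).1
    rw [← hlaw] at h1
    exact h1.comp_measurable hηm
  · intro S hSm hS
    obtain ⟨h1, h2⟩ := kacRice hp.measurable hν hg hd hfin hSm hS
    rw [← h2, ← hlaw, lintegral_map' (by rwa [hlaw]) hηm.aemeasurable]
    exact lintegral_congr fun ω => zeroCount_eq hreal S ω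
  · intro x hK hΔ
    obtain ⟨k, hk⟩ := exists_mem_firstNonzero (g := fun j (x : ℝ) => (f j x).re) hK
    obtain ⟨D, hD, hD0, hmap, hs⟩ := exists_joint_density (ν := ν) hp hp0 hM hν
      (g := fun j => (f j x).re) (g' := fun j => (deriv (f j) x).re) hk.1 hΔ
    have hnn : ∀ y : ℝ, 0 ≤ |y| * D (0, y) := fun y => mul_nonneg (abs_nonneg y) (hD0 _)
    have hmeas : AEStronglyMeasurable fun y : ℝ => |y| * D (0, y) :=
      (by fun_prop : Continuous fun y : ℝ => |y| * D (0, y)).aestronglyMeasurable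
    refine ⟨D, ⟨hD, hD0, ?_⟩, ⟨hmeas, ?_⟩, ?_⟩
    · rw [← hmap, ← hlaw, Measure.map_map (by fun_prop) hηm]
      congr 1
      ext1 ω
      simp only [deriv_P_re hf, P_ofReal hreal, Complex.ofReal_re, comp_apply]
    · rw [hasFiniteIntegral_iff_ofReal (Eventually.of_forall hnn), ← hs]
      exact (hfin k x hk.1).lt_top
    · rw [zeroDensity_eq_of_mem hk, hs, integral_eq_lintegral_of_nonneg_ae
        (Eventually.of_forall hnn) hmeas]

end RandomSums

theorem theorem2 {Ω : Type*} [MeasurableSpace Ω] (μ : Measure Ω) [IsProbabilityMeasure μ]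
    (n : ℕ) (η : Fin (n + 1) → Ω → ℝ)
    (hη : ∀ k, Measurable (η k))
    (hindep : iIndepFun η μ)
    (hident : ∀ i j, IdentDistrib (η i) (η j) μ μ)
    (hmean : ∀ k, ∫ ω, η k ω ∂μ = 0)
    (hvar : ∀ k, ∫ ω, η k ω ^ 2 ∂μ = 1)
    (f : Fin (n + 1) → ℂ → ℂ)
    (hf : ∀ k, Differentiable ℂ (f k))
    (hreal : ∀ k, ∀ x : ℝ, (f k x).im = 0)
    (φ : ℝ → ℂ) (hφ : ∀ k, φ = charFun (μ.map (η k)))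
    (a q C₂ C₃ : ℝ) (ha : 0 < a) (hq : 1 ≤ q) (hC₂ : 0 < C₂) (hC₃ : 0 < C₃)
    (hdecay : ∀ s : ℝ, ‖φ s‖ ≤ 1 / (1 + a * s ^ 2) ^ q)
    (hdiff : ∀ j < 3, Differentiable ℝ (iteratedDeriv j φ))
    (hφ₂ : ∀ s : ℝ, ‖iteratedDeriv 2 φ s‖ ≤ C₂)
    (hφ₃ : ∀ s : ℝ, ‖iteratedDeriv 3 φ s‖ ≤ C₃) :
    ∃ ρ : ℝ → ℝ, RandomSum.IsRealZeroDensity μ η f ρ ∧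
      ∀ x : ℝ, RandomSum.K f x ≠ 0 →
        ρ x ≤ RandomSum.scriptK f x * (1 / (a * q)) *
          (RandomSum.k₁ + C₃ * RandomSum.k₂ +
            1 / √(a * q) * (C₂ * (RandomSum.k₃ + C₂ * RandomSum.k₄))) := by
  -- The proof yields `ρ ≤ √3 / √(aq) · 𝒦`. This is stronger than the claim, because
  -- `C₂ ≥ |φ''(0)| = 1` and `aq ≤ 9 / 17`; the bound on `φ'''` is not needed.
  have hb : 0 < a * q := by positivity
  set ν : Measure ℝ := μ.map (η 0) with hνdef
  have hνp : IsProbabilityMeasure ν := Measure.isProbabilityMeasure_map (hη 0).aemeasurable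
  have hlaw : μ.map (fun ω j => η j ω) = Measure.pi fun _ => ν := by
    rw [(iIndepFun_iff_map_fun_eq_pi_map fun k => (hη k).aemeasurable).1 hindep]
    congr 1
    ext1 k
    exact (hident k 0).map_eq
  have hchar : ∀ s, ‖charFun ν s‖ ≤ 1 / (1 + a * q * s ^ 2) := fun s =>
    norm_le_one_div_one_add_mul_of_rpow ha hq (by rw [← hφ 0]; exact hdecay s)
  have h0 : ∫ x, x ∂ν = 0 := by
    rw [hνdef, integral_map (hη 0).aemeasurable (by fun_prop)]
    exact hmean 0
  have h2 : ∫ x, x ^ 2 ∂ν = 1 := by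
    rw [hνdef, integral_map (hη 0).aemeasurable (by fun_prop)]
    exact hvar 0
  have hmem : MemLp id 2 ν := by
    -- The integral of a non-integrable function is 0 by convention, so the value 1 already contains
    -- square integrability.
    refine (memLp_two_iff_integrable_sq aestronglyMeasurable_id).2 ?_
    by_contra hni
    simp only [id] at hni
    rw [integral_undef hni] at h2
    exact zero_ne_one h2
  obtain ⟨p, hp, hp0, hM, hν⟩ := exists_continuous_density_of_norm_charFun_le ν hb hchar
  have hbound : ∀ (k : Fin (n + 1)) (x : ℝ), (f k x).re ≠ 0 →
      sliceIntegral ν p (fun j => (f j x).re) k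
        (fun v => ENNReal.ofReal |∑ j, v j * (deriv (f j) x).re|) 0
      ≤ ENNReal.ofReal (√3 / √(a * q) * RandomSum.scriptK f x) := fun k x hk =>
    sliceIntegral_abs_le hp hν hb hchar hmem h0 h2 (g := fun j => (f j x).re) hk _
  refine ⟨_, isRealZeroDensity_zeroDensity hη hlaw hf hreal hp hp0 hM hν fun k x hk =>
    ne_top_of_le_ne_top ENNReal.ofReal_ne_top (hbound k x hk), fun x hx => ?_⟩
  obtain ⟨k, hk⟩ := exists_mem_firstNonzero (g := fun j (x : ℝ) => (f j x).re) hx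
  have hscript : 0 ≤ RandomSum.scriptK f x :=
    div_nonneg (Real.sqrt_nonneg _) (Finset.sum_nonneg fun _ _ => sq_nonneg _)
  have hC₂1 : 1 ≤ C₂ := by
    rw [← norm_iteratedDeriv_two_charFun_zero hmem h2, ← hφ 0]
    exact hφ₂ 0
  rw [zeroDensity_eq_of_mem hk]
  calc _ ≤ √3 / √(a * q) * RandomSum.scriptK f x :=
        ENNReal.toReal_le_of_le_ofReal (by positivity) (hbound k x hk.1)
    _ ≤ _ := by
        rw [mul_comm, mul_assoc]
        exact mul_le_mul_of_nonneg_left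
          (sqrt_three_div_sqrt_le hb (le_of_norm_charFun_le hb hmem h2 hchar) hC₂1 hC₃.le) hscript
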